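/- Let $X$ be a complete (equivalently, projective), irreducible, non-singular curve over an algebraically closed field $k$, with function field $\Sigma$, and let $p$ be a prime different from $\operatorname{char} k$. For a closed point $x\in X$ let $K_x$ be the completion of $\Sigma$ at the valuation $\upsilon_x$ of $\mathcal O_{X,x}$, let $A_x\subset K_x$ be its valuation ring, and let $\mathbb A_X=\{(\alpha_x)\in\prod_x K_x:\alpha_x\in A_x\text{ for almost all }x\}$ be the adele ring, the product being over the closed points of $X$. A Galois extension $(S,G)$ of a commutative ring $R$ is a commutative ring extension $S\supseteq R$ with a faithful action of a finite group $G$ by $R$-algebra automorphisms such that $S^G=R$, $S$ is a separable $R$-algebra, and any two distinct $g,h\in G$ are strongly distinct (for every nonzero idempotent $e\in S$ there is $s\in S$ with $g(s)e\ne h(s)e$); it is $p$-cyclic if $|G|=p$. Two such extensions $(S_1,G_1)$, $(S_2,G_2)$ are conjugate if there are an $R$-algebra isomorphism $\phi:S_1\to S_2$ and a group isomorphism $\tau:G_1\to G_2$ with $\phi\circ g=\tau(g)\circ\phi$ for all $g\in G_1$. Let $\mathcal C_p$ be the cyclic group of order $p$, and let $H(R,\mathcal C_p)$ be the set of $\mathcal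 C_p$-Galois extensions of $R$ up to $\mathcal C_p$-equivariant $R$-algebra isomorphism; $\operatorname{Aut}(\mathcal C_p)$ acts on it by twisting the action. Then: 1. Sending a $\mathcal C_p$-Galois extension $(S,\mathcal C_p)$ to its conjugacy class induces a bijection $$H(\mathbb A_X,\mathcal C_p)/\operatorname{Aut}(\mathcal C_p)\;\longleftrightarrow\;\{\text{conjugacy classes of $p$-cyclic Galois extensions }(S,G)\text{ of }\mathbb A_X\}.$$ 2. There is a bijection $$\{\text{conjugacy classes of $p$-cyclic Galois extensions }(S,G)\text{ of }\mathbb A_X\}\;\longleftrightarrow\;\coprod_{\mathfrak R}\Bigl(\prod_{x\in\mathfrak R}(\mathbb Z/p)^*\Bigr)\Big/(\mathbb Z/p)^*,$$ where $\mathfrak R$ ranges over the finite sets of closed points of $X$ and $(\mathbb Z/p)^*$ acts on tuples by simultaneous multiplication. It is a stratification by the ramification locus, given by local Kummer symbols, as follows. Let $(S,G)$ be a $p$-cyclic Galois extension of $\mathbb A_X$. Then $S\cong\mathbb A_X[T]/(T^p-t)$ as $\mathbb A_X$-algebras for some idele $t\in\mathbb A_X^*$. For every such $t$, every generator $g$ of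 $G$, every primitive $p$-th root of unity $\zeta\in k$ and every choice of uniformizers $z_x\in K_x$ (that is, $\upsilon_x(z_x)=1$), the set $\mathfrak R=\{x:p\nmid\upsilon_x(t_x)\}$ is finite and there is a tuple $(v_x)_{x\in\mathfrak R}\in\prod_{x\in\mathfrak R}(\mathbb Z/p)^*$ such that, for each $x\in\mathfrak R$, the element $z_x$ has a $p$-th root in $S_x=S\otimes_{\mathbb A_X}K_x$ and the automorphism $g_x$ of $S_x$ induced by $g$ satisfies $g_x(\beta)=\zeta^{v_x}\beta$ for every $\beta\in S_x$ with $\beta^p=z_x$. The bijection sends the class of $(S,G)$ to $\mathfrak R$ together with the class of $(v_x)_{x\in\mathfrak R}$. -/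

import Mathlib

open AlgebraicGeometry CategoryTheory IsDedekindDomain
open scoped RestrictedProduct TensorProduct WithZero Polynomial

universe u v w

/-! ## Curves, their local fields and the adele ring -/

/-- The closed points of a scheme. -/
abbrev ClosedPoint (X : Scheme.{u}) : Type u := {x : X // IsClosed ({x} : Set X)}

/-- An integral scheme which is a non-singular curve: the local ring at every closed point is a
regular local ring of Krull dimension one. -/
class NonsingularCurve (X : Scheme.{u}) : Prop extends IsIntegral X where
  regular (x : ClosedPoint X) : IsRegularLocalRing (X.presheaf.stalk x.1)
  dim_one (x : ClosedPoint X) : ringKrullDim (X.presheaf.stalk x.1) = 1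

section Adeles

variable (X : Scheme.{u}) [NonsingularCurve X]

/-- The local ring at a closed point of a non-singular curve is a discrete valuation ring. -/
instance stalk_isDVR (x : ClosedPoint X) : IsDiscreteValuationRing (X.presheaf.stalk x.1) := by
  have hreg := NonsingularCurve.regular x
  have hdim := NonsingularCurve.dim_one x
  have hfield : ¬ IsField (X.presheaf.stalk x.1) := by
    intro h
    rw [ringKrullDim_eq_zero_of_isField h] at hdim
    exact zero_ne_one hdim
  refine ((IsDiscreteValuationRing.TFAE _ hfield).out 0 5).mpr ?_
  have h := (IsRegularLocalRing.iff_finrank_cotangentSpace _).mp hreg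
  rw [hdim] at h
  exact_mod_cast h

/-- The closed point `x` as a place of the function field: the maximal ideal of the discrete
valuation ring `𝒪_x`. -/
noncomputable abbrev place (x : ClosedPoint X) : HeightOneSpectrum (X.presheaf.stalk x.1) :=
  IsDiscreteValuationRing.maximalIdeal (X.presheaf.stalk x.1)

/-- The field `K_x`: the completion of the function field of `X` at the valuation of `𝒪_x`. -/
noncomputable abbrev LocalField (x : ClosedPoint X) : Type u :=
  (place X x).adicCompletion X.functionField

/-- The ring `A_x`, the completion of `𝒪_x`, as the valuation ring of `K_x`. -/
noncomputable abbrev LocalIntegers (x : ClosedPoint X) : ValuationSubring (LocalField X x) :=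
  (place X x).adicCompletionIntegers X.functionField

/-- The adele ring `𝔸_X`: the restricted product of the `K_x` with respect to the `A_x` over the
closed points `x` of `X`. -/
noncomputable abbrev Adele : Type u :=
  Πʳ x : ClosedPoint X, [LocalField X x, LocalIntegers X x]

variable {X}

/-- The normalized additive valuation `υ_x : K_x → ℤ` (with the convention `υ_x 0 = 0`; it is only
used on nonzero elements). -/
noncomputable def ord (x : ClosedPoint X) (a : LocalField X x) : ℤ :=
  -WithZero.log (Valued.v a : ℤᵐ⁰)

/-- The ramification locus of an idele `t`, relative to `p`: the closed points `x` such that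
`υ_x (t_x)` is not divisible by `p`. -/
def ramificationLocus (p : ℕ) (t : (Adele X)ˣ) : Set (ClosedPoint X) :=
  {x | ¬ (p : ℤ) ∣ ord x ((t : Adele X) x)}

/-- `K_x` is an algebra over `𝔸_X` by projection to the `x`-component. -/
noncomputable instance adeleAlgebraLocalField (x : ClosedPoint X) :
    Algebra (Adele X) (LocalField X x) :=
  (RestrictedProduct.evalRingHom (LocalField X) x).toAlgebra

/-- The embedding of the constants: `k → Γ(X, 𝒪_X) → Σ → K_x`. -/
noncomputable def constants (k : Type u) [Field k] [X.Over (Spec (CommRingCat.of k))]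
    (x : ClosedPoint X) : k →+* LocalField X x :=
  (algebraMap X.functionField (LocalField X x)).comp
    ((Scheme.ΓSpecIso (CommRingCat.of k)).inv ≫ (X ↘ Spec (CommRingCat.of k)).appTop ≫
      X.presheaf.germ ⊤ (genericPoint X) trivial).hom

/-- The adelic algebra `𝔸_X[T] / (T ^ p - t)`. -/
noncomputable abbrev AdelicAlgebra (p : ℕ) (t : (Adele X)ˣ) : Type u :=
  AdjoinRoot (Polynomial.X ^ p - Polynomial.C (t : Adele X))

end Adeles

/-! ## Galois extensions of commutative rings -/

/-- A commutative `R`-algebra `S` is separable: `S ⊗[R] S` has a separability idempotent, that is,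
the multiplication `S ⊗[R] S → S` splits as a map of `S ⊗[R] S`-modules. -/
def IsSeparableExtension (R : Type u) (S : Type v) [CommRing R] [CommRing S] [Algebra R S] :
    Prop :=
  ∃ e : S ⊗[R] S, Algebra.TensorProduct.lmul' R (S := S) e = 1 ∧
    ∀ s : S, (s ⊗ₜ[R] (1 : S)) * e = ((1 : S) ⊗ₜ[R] s) * e

/-- Two ring homomorphisms are strongly distinct if no nonzero idempotent of the target
equalizes them. -/
def StronglyDistinct {S : Type u} {T : Type v} [CommRing S] [CommRing T] (f g : S →+* T) : Prop :=
  ∀ e : T, IsIdempotentElem e → e ≠ 0 → ∃ s : S, f s * e ≠ g s * e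

/-- `S` is a Galois ring extension of `R` with respect to the given action of `G` on `S` by
`R`-algebra automorphisms. -/
structure IsGaloisExtension (R : Type u) (S : Type v) (G : Type w) [CommRing R] [CommRing S]
    [Algebra R S] [Group G] [MulSemiringAction G S] [SMulCommClass G R S] : Prop where
  finite : Finite G
  injective : Function.Injective (algebraMap R S)
  faithful : FaithfulSMul G S
  fixed : ∀ s : S, (∀ g : G, g • s = s) → ∃ r : R, algebraMap R S r = s
  separable : IsSeparableExtension R S
  distinct : ∀ g h : G, g ≠ h →
    StronglyDistinct (MulSemiringAction.toRingHom G S g) (MulSemiringAction.toRingHom G S h)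

/-- A `G`-Galois extension `(S, G)` of `R`. -/
structure GaloisExtension (R : Type u) [CommRing R] (G : Type v) [Group G] where
  /-- the underlying ring of the extension -/
  S : Type u
  [commRing : CommRing S]
  [algebra : Algebra R S]
  [action : MulSemiringAction G S]
  [smulComm : SMulCommClass G R S]
  isGalois : IsGaloisExtension R S G

attribute [instance] GaloisExtension.commRing GaloisExtension.algebra GaloisExtension.action
  GaloisExtension.smulComm

namespace GaloisExtension

variable {R : Type u} [CommRing R]

/-- `(S₁, G₁)` and `(S₂, G₂)` are conjugate: there are an `R`-algebra isomorphism `φ` and a group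
isomorphism `τ` with `φ ∘ g = τ g ∘ φ` for all `g`. -/
def Conjugate {G₁ : Type v} {G₂ : Type w} [Group G₁] [Group G₂] (E₁ : GaloisExtension R G₁)
    (E₂ : GaloisExtension R G₂) : Prop :=
  ∃ (φ : E₁.S ≃ₐ[R] E₂.S) (τ : G₁ ≃* G₂), ∀ (g : G₁) (s : E₁.S), φ (g • s) = τ g • φ s

variable {G : Type v} [Group G]

/-- Equivariant isomorphism of `G`-Galois extensions, for a fixed group `G`. -/
def EquivariantlyIso (E₁ E₂ : GaloisExtension R G) : Prop :=
  ∃ φ : E₁.S ≃ₐ[R] E₂.S, ∀ (g : G) (s : E₁.S), φ (g • s) = g • φ s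

/-- Equivariant isomorphism is an equivalence relation. -/
instance equivariantSetoid (R : Type u) [CommRing R] (G : Type v) [Group G] :
    Setoid (GaloisExtension R G) where
  r := EquivariantlyIso
  iseqv := by
    refine ⟨fun E => ⟨AlgEquiv.refl, fun _ _ => rfl⟩, ?_, ?_⟩
    · rintro E₁ E₂ ⟨φ, h⟩
      exact ⟨φ.symm, fun g s => by rw [AlgEquiv.symm_apply_eq, h, AlgEquiv.apply_symm_apply]⟩
    · rintro E₁ E₂ E₃ ⟨φ, h⟩ ⟨ψ, h'⟩
      exact ⟨φ.trans ψ, fun g s => by simp [h, h']⟩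

/-- The action of `G` on `S` twisted by `τ`: the element `g` acts as `τ g` did. -/
abbrev twistAction (E : GaloisExtension R G) (τ : MulAut G) : MulSemiringAction G E.S :=
  MulSemiringAction.compHom E.S τ.toMonoidHom

/-- The twisted action is by `R`-algebra automorphisms. -/
theorem twist_smulComm (E : GaloisExtension R G) (τ : MulAut G) :
    @SMulCommClass G R E.S (E.twistAction τ).toSMul _ :=
  @SMulCommClass.mk G R E.S (E.twistAction τ).toSMul _ fun g r s => smul_comm (τ g) r s

/-- The twisted action is Galois. -/
theorem twist_isGalois (E : GaloisExtension R G) (τ : MulAut G) :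
    @IsGaloisExtension R E.S G _ _ _ _ (E.twistAction τ) (E.twist_smulComm τ) :=
  @IsGaloisExtension.mk R E.S G _ _ _ _ (E.twistAction τ) (E.twist_smulComm τ)
    E.isGalois.finite E.isGalois.injective
    (@FaithfulSMul.mk G E.S (E.twistAction τ).toSMul fun {_ _} hgh =>
      τ.injective (E.isGalois.faithful.eq_of_smul_eq_smul hgh))
    (fun s hs => E.isGalois.fixed s fun g => by
      have h : τ (τ.symm g) • s = s := hs (τ.symm g)
      rwa [MulEquiv.apply_symm_apply] at h)
    E.isGalois.separable
    (fun g h hgh => E.isGalois.distinct (τ g) (τ h) (τ.injective.ne hgh))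

/-- The twist `(S, G)^τ`: the same ring extension, with `g` now acting as `τ g` did. -/
def twist (E : GaloisExtension R G) (τ : MulAut G) : GaloisExtension R G :=
  @GaloisExtension.mk R _ G _ E.S _ _ (E.twistAction τ) (E.twist_smulComm τ) (E.twist_isGalois τ)

/-- In the twist by `τ`, the element `g` acts as `τ g` does in the original extension. -/
theorem twist_smul (E : GaloisExtension R G) (τ : MulAut G) (g : G) (s : E.S) :
    (E.twist τ).action.toSMul.smul g s = E.action.toSMul.smul (τ g) s :=
  rfl

end GaloisExtension

/-- The underlying set of the Harrison group `H(R, G)`: the `G`-Galois extensions of `R` up to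
equivariant isomorphism. -/
def Harrison (R : Type u) [CommRing R] (G : Type v) [Group G] : Type (max (u + 1) v) :=
  Quotient (GaloisExtension.equivariantSetoid R G)

/-- The class of a `G`-Galois extension in the Harrison group. -/
def Harrison.mk {R : Type u} [CommRing R] {G : Type v} [Group G] (E : GaloisExtension R G) :
    Harrison R G :=
  Quotient.mk _ E

/-- `Aut(G)` acts on `H(R, G)` by functoriality: `τ` sends the class of `(S, G)` to that of the
twist of `(S, G)` by the inverse of `τ`. -/
instance harrisonAction (R : Type u) [CommRing R] (G : Type v) [Group G] :
    MulAction (MulAut G) (Harrison R G) where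
  smul τ := Quotient.map (fun E => E.twist τ⁻¹) fun _ _ ⟨φ, h⟩ => ⟨φ, fun g s => h (τ⁻¹ g) s⟩
  one_smul c := by
    induction c using Quotient.inductionOn with
    | h E => exact Quotient.sound ⟨AlgEquiv.refl, fun _ _ => rfl⟩
  mul_smul σ τ c := by
    induction c using Quotient.inductionOn with
    | h E => exact Quotient.sound ⟨AlgEquiv.refl, fun _ _ => rfl⟩

/-- A `p`-cyclic Galois extension `(S, G)` of `R`: a Galois extension whose group, which is part of
the data, has prime order `p`. Every finite group is isomorphic to one in `Type`. -/
structure PCyclicExtension (R : Type u) [CommRing R] (p : ℕ) where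
  /-- the Galois group -/
  G : Type
  [group : Group G]
  card_eq : Nat.card G = p
  /-- the Galois extension -/
  ext : GaloisExtension R G

attribute [instance] PCyclicExtension.group

/-- The cyclic group `C_p`. -/
abbrev CyclicGroup (p : ℕ) : Type := Multiplicative (ZMod p)

/-- A `C_p`-Galois extension is a `p`-cyclic Galois extension. -/
def GaloisExtension.toPCyclic {R : Type u} [CommRing R] {p : ℕ}
    (E : GaloisExtension R (CyclicGroup p)) : PCyclicExtension R p where
  G := CyclicGroup p
  card_eq := (Nat.card_congr Multiplicative.toAdd).trans (Nat.card_zmod p)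
  ext := E

/-- Conjugacy of `p`-cyclic Galois extensions is an equivalence relation. -/
instance conjugacySetoid (R : Type u) [CommRing R] (p : ℕ) : Setoid (PCyclicExtension R p) where
  r E₁ E₂ := E₁.ext.Conjugate E₂.ext
  iseqv := by
    refine ⟨fun E => ⟨AlgEquiv.refl, MulEquiv.refl _, fun _ _ => rfl⟩, ?_, ?_⟩
    · rintro E₁ E₂ ⟨φ, τ, h⟩
      exact ⟨φ.symm, τ.symm, fun g s => by
        rw [AlgEquiv.symm_apply_eq, h, AlgEquiv.apply_symm_apply, MulEquiv.apply_symm_apply]⟩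
    · rintro E₁ E₂ E₃ ⟨φ, τ, h⟩ ⟨ψ, σ, h'⟩
      exact ⟨φ.trans ψ, τ.trans σ, fun g s => by simp [h, h']⟩

/-- The set of conjugacy classes of `p`-cyclic Galois extensions of `R`. -/
def ConjugacyClasses (R : Type u) [CommRing R] (p : ℕ) : Type (u + 1) :=
  Quotient (conjugacySetoid R p)

/-- The conjugacy class of a `p`-cyclic Galois extension. -/
def ConjugacyClasses.mk {R : Type u} [CommRing R] {p : ℕ} (E : PCyclicExtension R p) :
    ConjugacyClasses R p :=
  Quotient.mk _ E

/-! ## Tuples over ramified points -/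

/-- The set `(∏_{x ∈ s} (ℤ/p)ˣ) / (ℤ/p)ˣ`, where `(ℤ/p)ˣ` acts by simultaneous multiplication. -/
abbrev TupleClass {ι : Type u} (p : ℕ) (s : Finset ι) : Type u :=
  MulAction.orbitRel.Quotient (ZMod p)ˣ (s → (ZMod p)ˣ)

/-- The class of a tuple. -/
def TupleClass.mk {ι : Type u} {p : ℕ} {s : Finset ι} (v : s → (ZMod p)ˣ) : TupleClass p s :=
  Quotient.mk _ v

section Kummer

variable {X : Scheme.{u}} [NonsingularCurve X] {G : Type v} [Group G]

/-- The component at `x` of the automorphism of `S` given by `g`: the induced automorphism of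
`S_x = K_x ⊗ S`. -/
noncomputable def localAction (E : GaloisExtension (Adele X) G) (x : ClosedPoint X) (g : G) :
    (LocalField X x ⊗[Adele X] E.S) →ₐ[LocalField X x] (LocalField X x ⊗[Adele X] E.S) :=
  Algebra.TensorProduct.map (AlgHom.id (LocalField X x) (LocalField X x))
    (MulSemiringAction.toAlgHom (Adele X) E.S g)

/-- The local Kummer symbol `⟨g_x, a⟩_x = g_x(a^{1/p}) / a^{1/p}` has the value `c`: the element
`a` of `K_x` has `p`-th roots in `S_x`, and `g_x` multiplies every one of them by `c`. -/
def IsKummerSymbol (p : ℕ) (E : GaloisExtension (Adele X) G) (x : ClosedPoint X) (g : G)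
    (a c : LocalField X x) : Prop :=
  (∃ β : LocalField X x ⊗[Adele X] E.S, β ^ p = algebraMap (LocalField X x) _ a) ∧
    ∀ β : LocalField X x ⊗[Adele X] E.S, β ^ p = algebraMap (LocalField X x) _ a →
      localAction E x g β = c • β

end Kummer

/-!
Kummer theory over the adele ring reduces the classification to the valuations of ideles modulo `p`.

*Kummer theory over a ring.* Let `R` contain a `p`-th root of unity `z` such that `p` and the
differences of distinct powers of `z` are units, and let `g` generate the group of a `p`-cyclic
Galois extension `S` of `R`. The image of the separability idempotent `∑ xᵢ ⊗ yᵢ` under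
`a ⊗ b ↦ a h(b)` is an idempotent on which `h` and `1` agree, so by strong distinctness
`∑ xᵢ h(yᵢ)` vanishes for `h ≠ 1` (`IsGaloisExtension.exists_dual_bases`). Lagrange resolvents turn
this relation into a partition of unity `∑ aᵢ bᵢ = 1` with `g(aᵢ) = z aᵢ` and `g(bᵢ) = z⁻¹ bᵢ`, so
that the `z`-eigenmodule of `g` is invertible. Over the adele ring it is even free: at every point
one of the summands `aᵢ bᵢ` has valuation at most `0`, and the `aᵢ` can be glued along such choices
(`hasOrthogonalSelections_adele`) to a unit `u` with `g(u) = z u`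
(`IsGaloisExtension.exists_kummer_unit`). Then `t = u ^ p` is an idele and
`S = 𝔸_X[T] / (T ^ p - t)` with `g(T) = z T`. Conversely, for every idele `t` this formula defines
a Galois extension, with separability idempotent `p⁻¹ ∑ Tⁱ ⊗ T⁻ⁱ`
(`exists_galoisExtension_kummer_unit`). The parameter `t` is unique up to `p`-th powers
for fixed `g` and `z`, and changing `g` or `z` raises it to a power prime to `p`
(`IsKummerParameter.pow_eq_pow_mul_pow`).

*Local fields.* The residue field at a closed point is the algebraically closed field `k`, and
one-units of `K_x` are `p`-th powers by a contraction argument, so an element of `K_x` is a `p`-th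
power if and only if its valuation is divisible by `p` (`exists_pow_eq_iff_dvd_ord`). Hence an idele
is determined up to `p`-th powers by its valuations modulo `p`, a function of finite support which
can be prescribed arbitrarily, and the conjugacy class of the extension is determined by this
function up to scaling (`exists_conjugacyClasses_equiv`). Its support is the ramification locus.

*Kummer symbols.* At a ramified point `S_x` is a field and a uniformizer has the form
`c ^ p t_x ^ a` with `a` the inverse of the valuation of `t_x` modulo `p`. Its `p`-th roots are the
elements `ζ ^ j c u ^ a`, which `g` multiplies by `ζ ^ a` (`isKummerSymbol_of_isKummerParameter`).
-/

/-! ### Roots of one-units in complete discretely valued fields -/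

section OneUnits

variable {K : Type u} [Field K] [Valued K ℤᵐ⁰]

theorem Valued.nonarchimedeanAddGroup : NonarchimedeanAddGroup K where
  is_nonarchimedean U hU := by
    obtain ⟨γ, hγ⟩ := Valued.mem_nhds_zero.mp hU
    exact ⟨⟨Valuation.ltAddSubgroup Valued.v.restrict γ, Valued.isOpen_ball _ _⟩, hγ⟩

theorem Valued.tendsto_zero_of_le_exp {f : ℕ → K}
    (hf : ∀ n : ℕ, Valued.v (f n) ≤ (WithZero.exp (-(n : ℤ)) : ℤᵐ⁰)) :
    Filter.Tendsto f Filter.atTop (nhds 0) := by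
  intro U hU
  obtain ⟨γ, hγ⟩ := Valued.mem_nhds_zero.mp hU
  set c : ℤᵐ⁰ := MonoidWithZeroHom.ValueGroup₀.embedding γ.1 with hc
  have hc0 : c ≠ 0 := (map_ne_zero _).mpr γ.ne_zero
  rw [Filter.mem_map, Filter.mem_atTop_sets]
  refine ⟨(-WithZero.log c + 1).toNat, fun n hn => hγ ?_⟩
  change Valued.v.restrict (f n) < γ.1
  rw [Valuation.restrict_lt_iff_lt_embedding]
  refine (hf n).trans_lt ?_
  rw [← WithZero.lt_log_iff_exp_lt hc0]
  omega

theorem Valued.le_exp_neg_one_of_lt_one {x : ℤᵐ⁰} (hx : x < 1) : x ≤ WithZero.exp (-1 : ℤ) := by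
  rw [← WithZero.lt_mul_exp_iff_le WithZero.exp_ne_zero, ← WithZero.exp_add]
  simpa using hx

theorem Valued.sub_one_lt_one_mul {x y : K} (hx : Valued.v (x - 1) < (1 : ℤᵐ⁰))
    (hy : Valued.v (y - 1) < (1 : ℤᵐ⁰)) : Valued.v (x * y - 1) < (1 : ℤᵐ⁰) := by
  have h : x * y - 1 = (x - 1) * (y - 1) + ((x - 1) + (y - 1)) := by ring
  rw [h]
  refine Valuation.map_add_lt _ ?_ (Valuation.map_add_lt _ hx hy)
  rw [map_mul]
  exact mul_lt_one_of_lt_of_le hx hy.le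

theorem Valued.sub_one_lt_one_pow {x : K} (hx : Valued.v (x - 1) < (1 : ℤᵐ⁰)) (n : ℕ) :
    Valued.v (x ^ n - 1) < (1 : ℤᵐ⁰) := by
  induction n with
  | zero => simp
  | succ n ih => rw [pow_succ]; exact sub_one_lt_one_mul ih hx

/-- The factor by which `x ↦ x + (a - x ^ p) / p` contracts distances between one-units. -/
theorem Valued.geomSum_contraction {p : ℕ} (hp : Valued.v (p : K) = (1 : ℤᵐ⁰)) {x y : K}
    (hx : Valued.v (x - 1) < (1 : ℤᵐ⁰)) (hy : Valued.v (y - 1) < (1 : ℤᵐ⁰)) :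
    Valued.v (1 - (∑ i ∈ Finset.range p, x ^ i * y ^ (p - 1 - i)) / p) < (1 : ℤᵐ⁰) := by
  have hp0 : (p : K) ≠ 0 := by
    intro h
    simp [h] at hp
  have h : 1 - (∑ i ∈ Finset.range p, x ^ i * y ^ (p - 1 - i)) / p =
      -(∑ i ∈ Finset.range p, (x ^ i * y ^ (p - 1 - i) - 1)) / p := by
    rw [Finset.sum_sub_distrib]
    field_simp
    simp
  rw [h, map_div₀, hp, div_one, Valuation.map_neg]
  exact Valuation.map_sum_lt _ one_ne_zero fun i _ =>
    sub_one_lt_one_mul (sub_one_lt_one_pow hx _) (sub_one_lt_one_pow hy _)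

/-- If `p` is a unit of the valuation ring of a complete discretely valued field, then every
one-unit is a `p`-th power: the map `x ↦ x + (a - x ^ p) / p` is a contraction of the group of
one-units whose fixed points are the `p`-th roots of `a`. -/
theorem Valued.exists_pow_eq_of_sub_one_lt_one [CompleteSpace K] {p : ℕ}
    (hp : Valued.v (p : K) = (1 : ℤᵐ⁰)) {a : K} (ha : Valued.v (a - 1) < (1 : ℤᵐ⁰)) :
    ∃ b : K, b ^ p = a := by
  have := Valued.nonarchimedeanAddGroup (K := K)
  have hp0 : (p : K) ≠ 0 := by
    intro h
    simp [h] at hp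
  let F : K → K := fun x => x + (a - x ^ p) / p
  have hF1 (x : K) (hx : Valued.v (x - 1) < (1 : ℤᵐ⁰)) : Valued.v (F x - 1) < (1 : ℤᵐ⁰) := by
    have h : F x - 1 = (x - 1) + ((a - 1) - (x ^ p - 1)) / p := by
      simp only [F]
      ring
    rw [h]
    refine Valuation.map_add_lt _ hx ?_
    rw [map_div₀, hp, div_one]
    exact Valuation.map_sub_lt _ ha (sub_one_lt_one_pow hx p)
  have hFc (x y : K) (hx : Valued.v (x - 1) < (1 : ℤᵐ⁰)) (hy : Valued.v (y - 1) < (1 : ℤᵐ⁰)) :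
      Valued.v (F x - F y) ≤ (WithZero.exp (-1 : ℤ) * Valued.v (x - y) : ℤᵐ⁰) := by
    have h : F x - F y =
        (1 - (∑ i ∈ Finset.range p, x ^ i * y ^ (p - 1 - i)) / p) * (x - y) := by
      have := (Commute.all x y).geom_sum₂_mul p
      simp only [F]
      field_simp
      rw [sub_mul, this]
      ring
    rw [h, map_mul]
    exact mul_le_mul_left (le_exp_neg_one_of_lt_one (geomSum_contraction hp hx hy)) _
  let f : ℕ → K := fun n => F^[n] 1
  have hfs (n : ℕ) : f (n + 1) = F (f n) := Function.iterate_succ_apply' F n 1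
  have hf1 (n : ℕ) : Valued.v (f n - 1) < (1 : ℤᵐ⁰) := by
    induction n with
    | zero => simp [f]
    | succ n ih => rw [hfs]; exact hF1 _ ih
  have hd (n : ℕ) : Valued.v (f (n + 1) - f n) ≤ (WithZero.exp (-(n : ℤ)) : ℤᵐ⁰) := by
    induction n with
    | zero =>
      have h : f (0 + 1) - f 0 = (f (0 + 1) - 1) - (f 0 - 1) := by ring
      rw [h]
      simpa using (Valuation.map_sub_lt _ (hf1 _) (hf1 _)).le
    | succ n ih =>
      rw [hfs (n + 1), hfs n]
      refine (hFc _ _ (hfs n ▸ hf1 (n + 1)) (hf1 n)).trans ?_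
      rw [← hfs n]
      refine (mul_le_mul_right ih _).trans ?_
      rw [← WithZero.exp_add]
      push_cast
      rw [neg_add, add_comm]
  obtain ⟨b, hb⟩ := cauchySeq_tendsto_of_complete
    (NonarchimedeanAddGroup.cauchySeq_of_tendsto_sub_nhds_zero (tendsto_zero_of_le_exp hd))
  have hFcont : Continuous F := by
    have : Continuous fun x : K => x + (a - x ^ p) * (p : K)⁻¹ := by fun_prop
    simpa only [F, div_eq_mul_inv] using this
  have h1 : Filter.Tendsto (fun n => f (n + 1)) Filter.atTop (nhds (F b)) := by
    simp only [hfs]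
    exact (hFcont.tendsto b).comp hb
  have h2 : F b = b := tendsto_nhds_unique h1 ((Filter.tendsto_add_atTop_iff_nat 1).mpr hb)
  refine ⟨b, ?_⟩
  have h3 : (a - b ^ p) / p = 0 := by simpa [F] using h2
  rw [div_eq_zero_iff, or_iff_left hp0, sub_eq_zero] at h3
  exact h3.symm

end OneUnits

/-! ### The constant field and the local fields of a curve -/

section LocalFields

variable (k : Type u) [Field k] {X : Scheme.{u}} [X.Over (Spec (CommRingCat.of k))]

/-- The embedding of the constant field into the local ring at a point. -/
noncomputable def stalkConstants (x : X) : k →+* X.presheaf.stalk x :=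
  ((Scheme.ΓSpecIso (CommRingCat.of k)).inv ≫ (X ↘ Spec (CommRingCat.of k)).appTop ≫
    X.presheaf.germ ⊤ x trivial).hom

/-- The residue field at a closed point is the field of constants. -/
theorem exists_sub_stalkConstants_mem_maximalIdeal [IsAlgClosed k]
    [LocallyOfFiniteType (X ↘ Spec (CommRingCat.of k))] (x : ClosedPoint X)
    (f : X.presheaf.stalk x.1) :
    ∃ c : k, f - stalkConstants k x.1 c ∈ IsLocalRing.maximalIdeal (X.presheaf.stalk x.1) := by
  let e := residueFieldIsoBase (X ↘ Spec (CommRingCat.of k)) x.1 x.2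
  have he : e.inv = (Scheme.ΓSpecIso (CommRingCat.of k)).inv ≫
      (X ↘ Spec (CommRingCat.of k)).appTop ≫ X.presheaf.germ ⊤ x.1 trivial ≫
        X.residue x.1 := by
    apply Spec.map_injective
    rw [SpecMap_residueFieldIsoBase_inv]
    simp only [Spec.map_comp, Category.assoc, Scheme.fromSpecResidueField,
      ← Scheme.fromSpecStalk_toSpecΓ, ← Scheme.toSpecΓ_naturality_assoc]
    rw [← SpecMap_ΓSpecIso_hom, ← Spec.map_comp, Iso.inv_hom_id, Spec.map_id,
      Category.comp_id]
  refine ⟨e.hom (X.residue x.1 f), ?_⟩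
  rw [← IsLocalRing.residue_eq_zero_iff, map_sub, sub_eq_zero]
  have h1 : e.inv (e.hom (X.residue x.1 f)) = X.residue x.1 f := by
    rw [← ConcreteCategory.comp_apply, Iso.hom_inv_id, ConcreteCategory.id_apply]
  have h2 (c : k) : e.inv c = X.residue x.1 (stalkConstants k x.1 c) := by
    rw [he]
    rfl
  exact h1.symm.trans (h2 _)

variable [NonsingularCurve X]

theorem constants_eq_algebraMap_stalkConstants (x : ClosedPoint X) (c : k) :
    constants k x c = algebraMap X.functionField (LocalField X x)
      (algebraMap (X.presheaf.stalk x.1) X.functionField (stalkConstants k x.1 c)) := by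
  have h : (X.presheaf.germ ⊤ (genericPoint X) trivial : X.presheaf.obj _ ⟶ _) =
      X.presheaf.germ ⊤ x.1 trivial ≫
        X.presheaf.stalkSpecializes ((genericPoint_spec X).specializes trivial) :=
    (X.presheaf.germ_stalkSpecializes _ _).symm
  unfold constants stalkConstants
  rw [h]
  rfl

variable {k} in
theorem valued_constants_le_one (x : ClosedPoint X) (c : k) :
    Valued.v (constants k x c) ≤ (1 : ℤᵐ⁰) := by
  rw [constants_eq_algebraMap_stalkConstants]
  exact (HeightOneSpectrum.valuedAdicCompletion_eq_valuation' (place X x) _).trans_le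
    (HeightOneSpectrum.valuation_le_one _ _)

variable {k} in
theorem valued_constants_eq_one (x : ClosedPoint X) {c : k} (hc : c ≠ 0) :
    Valued.v (constants k x c) = (1 : ℤᵐ⁰) := by
  refine le_antisymm (valued_constants_le_one x c) ?_
  have h : (Valued.v (constants k x c) : ℤᵐ⁰) * Valued.v (constants k x c⁻¹) = 1 := by
    rw [← map_mul, ← map_mul, mul_inv_cancel₀ hc, map_one, map_one]
  rw [← h]
  exact mul_le_of_le_one_right' (valued_constants_le_one x c⁻¹)

theorem exists_valued_sub_constants_lt_one [IsAlgClosed k]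
    [LocallyOfFiniteType (X ↘ Spec (CommRingCat.of k))] (x : ClosedPoint X)
    {a : LocalField X x} (ha : Valued.v a ≤ (1 : ℤᵐ⁰)) :
    ∃ c : k, Valued.v (a - constants k x c) < (1 : ℤᵐ⁰) := by
  obtain ⟨f, hf⟩ : ∃ f : X.functionField,
      Valued.v (a - algebraMap X.functionField (LocalField X x) f) < (1 : ℤᵐ⁰) := by
    have hopen : {y : LocalField X x | Valued.v (a - y) < (1 : ℤᵐ⁰)} ∈ nhds a := by
      refine Valued.mem_nhds.mpr ⟨1, fun y hy => ?_⟩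
      rw [Set.mem_ofPred_eq] at hy ⊢
      rw [Valuation.map_sub_swap]
      exact Valued.v.restrict_lt_one_iff.mp hy
    obtain ⟨y, hy, f, rfl⟩ := mem_closure_iff_nhds.mp
      ((place X x).denseRange_algebraMap X.functionField a) _ hopen
    exact ⟨f, hy⟩
  have hf1 : (place X x).valuation X.functionField f ≤ 1 := by
    rw [← HeightOneSpectrum.valuedAdicCompletion_eq_valuation' (place X x) f]
    have h := Valuation.map_sub_le Valued.v ha hf.le
    rwa [sub_sub_cancel] at h
  obtain ⟨r, hr⟩ := (place X x).exists_valuation_sub_lt_of_integer hf1 1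
  obtain ⟨c, hc⟩ := exists_sub_stalkConstants_mem_maximalIdeal k x r
  refine ⟨c, ?_⟩
  rw [constants_eq_algebraMap_stalkConstants]
  set φ := algebraMap X.functionField (LocalField X x)
  set ψ := algebraMap (X.presheaf.stalk x.1) X.functionField
  have h2 : Valued.v (φ (f - ψ r)) < (1 : ℤᵐ⁰) := by
    rw [map_sub, Valuation.map_sub_swap, ← map_sub]
    exact (HeightOneSpectrum.valuedAdicCompletion_eq_valuation' (place X x) _).trans_lt hr
  have h3 : Valued.v (φ (ψ (r - stalkConstants k x.1 c))) < (1 : ℤᵐ⁰) :=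
    (HeightOneSpectrum.valuedAdicCompletion_eq_valuation' (place X x) _).trans_lt
      ((HeightOneSpectrum.valuation_lt_one_iff_mem _ _).mpr hc)
  have h : a - φ (ψ (stalkConstants k x.1 c)) =
      (a - φ f) + (φ (f - ψ r) + φ (ψ (r - stalkConstants k x.1 c))) := by
    simp only [map_sub]
    ring
  rw [h]
  exact Valuation.map_add_lt _ hf (Valuation.map_add_lt _ h2 h3)

/-- The units of `A_x` are `p`-th powers: modulo the constants they are one-units. -/
theorem exists_pow_eq_of_valued_eq_one [IsAlgClosed k]
    [LocallyOfFiniteType (X ↘ Spec (CommRingCat.of k))] {p : ℕ} (hp : (p : k) ≠ 0)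
    (x : ClosedPoint X) {a : LocalField X x} (ha : Valued.v a = (1 : ℤᵐ⁰)) :
    ∃ b : LocalField X x, b ^ p = a := by
  obtain ⟨c, hc⟩ := exists_valued_sub_constants_lt_one k x ha.le
  have hc0 : c ≠ 0 := by
    rintro rfl
    rw [map_zero, sub_zero, ha] at hc
    exact hc.false
  have hp' : 0 < p := Nat.pos_of_ne_zero (by rintro rfl; simp at hp)
  obtain ⟨d, hd⟩ := IsAlgClosed.exists_pow_nat_eq c hp'
  have hc1 := valued_constants_eq_one x hc0
  have hcx : constants k x c ≠ 0 := (map_ne_zero _).mpr hc0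
  obtain ⟨b, hb⟩ := Valued.exists_pow_eq_of_sub_one_lt_one (K := LocalField X x) (p := p)
    (by rw [← map_natCast (constants k x)]; exact valued_constants_eq_one x hp)
    (a := a / constants k x c) (by
      have h : a / constants k x c - 1 = (a - constants k x c) / constants k x c := by
        field_simp
      rw [h, map_div₀, hc1, div_one]
      exact hc)
  exact ⟨constants k x d * b, by rw [mul_pow, hb, ← map_pow, hd]; field_simp⟩

end LocalFields

section Ord

variable {X : Scheme.{u}} [NonsingularCurve X]

theorem ord_mul (x : ClosedPoint X) {a b : LocalField X x} (ha : a ≠ 0) (hb : b ≠ 0) :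
    ord x (a * b) = ord x a + ord x b := by
  unfold ord
  rw [map_mul, WithZero.log_mul ((Valuation.ne_zero_iff _).mpr ha)
    ((Valuation.ne_zero_iff _).mpr hb), neg_add]

theorem ord_one (x : ClosedPoint X) : ord x 1 = 0 := by
  simp [ord]

theorem ord_pow (x : ClosedPoint X) (a : LocalField X x) (n : ℕ) :
    ord x (a ^ n) = n * ord x a := by
  simp [ord, WithZero.log_pow]

theorem ord_eq_zero_iff (x : ClosedPoint X) {a : LocalField X x} (ha : a ≠ 0) :
    ord x a = 0 ↔ Valued.v a = (1 : ℤᵐ⁰) := by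
  have h : (Valued.v a : ℤᵐ⁰) ≠ 0 := (Valuation.ne_zero_iff _).mpr ha
  unfold ord
  rw [neg_eq_zero]
  exact ⟨fun h0 => by rw [← WithZero.exp_log h, h0, WithZero.exp_zero],
    fun h1 => by rw [h1, WithZero.log_one]⟩

theorem exists_ord_eq_one (x : ClosedPoint X) : ∃ a : LocalField X x, a ≠ 0 ∧ ord x a = 1 := by
  obtain ⟨a, ha⟩ := HeightOneSpectrum.valuedAdicCompletion_surjective X.functionField (place X x)
    (WithZero.exp (-1 : ℤ))
  refine ⟨a, ?_, ?_⟩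
  · rintro rfl
    rw [map_zero] at ha
    exact WithZero.exp_ne_zero ha.symm
  · unfold ord
    rw [ha]
    simp

/-- Over an algebraically closed constant field, the valuation decides which elements of `K_x` are
`p`-th powers. -/
theorem exists_pow_eq_iff_dvd_ord (k : Type u) [Field k] [IsAlgClosed k]
    [X.Over (Spec (CommRingCat.of k))] [LocallyOfFiniteType (X ↘ Spec (CommRingCat.of k))] {p : ℕ}
    (hp : (p : k) ≠ 0) (x : ClosedPoint X) {a : LocalField X x} (ha : a ≠ 0) :
    (∃ b : LocalField X x, b ^ p = a) ↔ (p : ℤ) ∣ ord x a := by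
  constructor
  · rintro ⟨b, rfl⟩
    exact ⟨ord x b, ord_pow x b p⟩
  · rintro ⟨n, hn⟩
    obtain ⟨π, hπ0, hπ⟩ := exists_ord_eq_one x
    have hz (m : ℤ) : ord x (π ^ m) = m := by
      have h : (π ^ m) * π ^ (-m) = 1 := by rw [← zpow_add₀ hπ0]; simp
      obtain ⟨j, rfl | rfl⟩ := m.eq_nat_or_neg
      · rw [zpow_natCast, ord_pow, hπ, mul_one]
      · have h2 := ord_mul x (zpow_ne_zero (-(j : ℤ)) hπ0) (zpow_ne_zero (- -(j : ℤ)) hπ0)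
        rw [h, ord_one, neg_neg, zpow_natCast, ord_pow, hπ, mul_one] at h2
        omega
    have hπn : π ^ (-n) ≠ 0 := zpow_ne_zero _ hπ0
    have h0 : a * (π ^ (-n)) ^ p ≠ 0 := mul_ne_zero ha (pow_ne_zero _ hπn)
    obtain ⟨b, hb⟩ := exists_pow_eq_of_valued_eq_one k hp x ((ord_eq_zero_iff x h0).mp (by
      rw [ord_mul x ha (pow_ne_zero _ hπn), ord_pow, hz, hn]
      ring))
    refine ⟨b * π ^ n, ?_⟩
    rw [mul_pow, hb, mul_assoc, ← mul_pow, ← zpow_add₀ hπ0]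
    simp

end Ord

/-! ### Ideles -/

section Ideles

variable {X : Scheme.{u}} [NonsingularCurve X]

theorem mem_localIntegers (x : ClosedPoint X) {a : LocalField X x} :
    a ∈ LocalIntegers X x ↔ Valued.v a ≤ (1 : ℤᵐ⁰) :=
  HeightOneSpectrum.mem_adicCompletionIntegers _ _ _

/-- The idele with given nonzero components, almost all of which are units. -/
noncomputable def ideleOfComponents (f : (x : ClosedPoint X) → LocalField X x)
    (h0 : ∀ x, f x ≠ 0) (hf : ∀ᶠ x in Filter.cofinite, Valued.v (f x) = (1 : ℤᵐ⁰)) :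
    (Adele X)ˣ where
  val := ⟨f, hf.mono fun x hx => (mem_localIntegers x).mpr hx.le⟩
  inv := ⟨fun x => (f x)⁻¹, hf.mono fun x hx => (mem_localIntegers x).mpr (by
    rw [map_inv₀, hx, inv_one])⟩
  val_inv := RestrictedProduct.ext _ _ fun x => mul_inv_cancel₀ (h0 x)
  inv_val := RestrictedProduct.ext _ _ fun x => inv_mul_cancel₀ (h0 x)

theorem ideleOfComponents_apply (f : (x : ClosedPoint X) → LocalField X x)
    (h0 : ∀ x, f x ≠ 0) (hf : ∀ᶠ x in Filter.cofinite, Valued.v (f x) = (1 : ℤᵐ⁰))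
    (x : ClosedPoint X) : (ideleOfComponents f h0 hf : Adele X) x = f x :=
  rfl

theorem idele_apply_mul_inv (t : (Adele X)ˣ) (x : ClosedPoint X) :
    (t : Adele X) x * ((t⁻¹ : (Adele X)ˣ) : Adele X) x = 1 := by
  rw [← RestrictedProduct.mul_apply, Units.mul_inv, RestrictedProduct.one_apply]

theorem idele_apply_ne_zero (t : (Adele X)ˣ) (x : ClosedPoint X) : (t : Adele X) x ≠ 0 :=
  left_ne_zero_of_mul_eq_one (idele_apply_mul_inv t x)

theorem eventually_valued_idele_eq_one (t : (Adele X)ˣ) :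
    ∀ᶠ x in Filter.cofinite, Valued.v ((t : Adele X) x) = (1 : ℤᵐ⁰) := by
  filter_upwards [(t : Adele X).eventually, ((t⁻¹ : (Adele X)ˣ) : Adele X).eventually] with x h1 h2
  rw [SetLike.mem_coe, mem_localIntegers] at h1 h2
  refine le_antisymm h1 ?_
  have h := congrArg (Valued.v : LocalField X x → ℤᵐ⁰) (idele_apply_mul_inv t x)
  rw [map_mul, map_one] at h
  rw [← h]
  exact mul_le_of_le_one_right' h2

theorem finite_ramificationLocus (p : ℕ) (t : (Adele X)ˣ) : (ramificationLocus p t).Finite := by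
  refine (Filter.eventually_cofinite.mp (eventually_valued_idele_eq_one t)).subset fun x hx h => ?_
  exact hx (((ord_eq_zero_iff x (idele_apply_ne_zero t x)).mpr h) ▸ dvd_zero _)

theorem exists_idele_ord_eq (s : Finset (ClosedPoint X)) (n : ClosedPoint X → ℕ) :
    ∃ t : (Adele X)ˣ, (∀ x ∈ s, ord x ((t : Adele X) x) = n x) ∧
      ∀ x ∉ s, ord x ((t : Adele X) x) = 0 := by
  classical
  choose π hπ0 hπ using exists_ord_eq_one (X := X)
  refine ⟨ideleOfComponents (fun x => if x ∈ s then π x ^ n x else 1) ?_ ?_, ?_, ?_⟩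
  · intro x
    split_ifs
    exacts [pow_ne_zero _ (hπ0 x), one_ne_zero]
  · refine Filter.eventually_cofinite.mpr (s.finite_toSet.subset fun x hx => ?_)
    by_contra hxs
    exact hx (by rw [if_neg (by simpa using hxs), map_one])
  · intro x hx
    rw [ideleOfComponents_apply, if_pos hx, ord_pow, hπ, mul_one]
  · intro x hx
    rw [ideleOfComponents_apply, if_neg hx, ord_one]

/-- An idele all of whose components have valuation divisible by `p` is a `p`-th power. -/
theorem exists_idele_pow_eq (k : Type u) [Field k] [IsAlgClosed k]
    [X.Over (Spec (CommRingCat.of k))] [LocallyOfFiniteType (X ↘ Spec (CommRingCat.of k))] {p : ℕ}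
    (hp : (p : k) ≠ 0) (t : (Adele X)ˣ) (ht : ∀ x, (p : ℤ) ∣ ord x ((t : Adele X) x)) :
    ∃ r : (Adele X)ˣ, r ^ p = t := by
  choose b hb using fun x =>
    (exists_pow_eq_iff_dvd_ord k hp x (idele_apply_ne_zero t x)).mpr (ht x)
  have hp0 : p ≠ 0 := by rintro rfl; simp at hp
  have hb0 (x : ClosedPoint X) : b x ≠ 0 := by
    intro h
    have := hb x
    rw [h, zero_pow hp0] at this
    exact idele_apply_ne_zero t x this.symm
  refine ⟨ideleOfComponents b hb0 ?_, ?_⟩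
  · filter_upwards [eventually_valued_idele_eq_one t] with x hx
    rw [← ord_eq_zero_iff x (idele_apply_ne_zero t x), ← hb, ord_pow] at hx
    rw [← ord_eq_zero_iff x (hb0 x)]
    simpa [hp0] using hx
  · refine Units.ext (RestrictedProduct.ext _ _ fun x => ?_)
    rw [Units.val_pow_eq_pow_val, RestrictedProduct.pow_apply]
    exact hb x

/-- The constants as adeles. -/
noncomputable def adeleConstants (k : Type u) [Field k] [X.Over (Spec (CommRingCat.of k))] :
    k →+* Adele X where
  toFun c := ⟨fun x => constants k x c,
    Filter.Eventually.of_forall fun x => (mem_localIntegers x).mpr (valued_constants_le_one x c)⟩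
  map_one' := RestrictedProduct.ext _ _ fun x => map_one (constants k x)
  map_mul' a b := RestrictedProduct.ext _ _ fun x => map_mul (constants k x) a b
  map_zero' := RestrictedProduct.ext _ _ fun x => map_zero (constants k x)
  map_add' a b := RestrictedProduct.ext _ _ fun x => map_add (constants k x) a b

/-- A proper curve has a closed point, so its adele ring is not the zero ring. -/
theorem nontrivial_adele (X : Scheme.{u}) [NonsingularCurve X] [CompactSpace X] :
    Nontrivial (Adele X) := by
  obtain ⟨x, -, hx⟩ := isClosed_univ.exists_closed_singleton (X := X) Set.univ_nonempty
  refine ⟨0, 1, fun h => ?_⟩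
  have h1 := congrArg (fun a : Adele X => a ⟨x, hx⟩) h
  exact zero_ne_one (α := LocalField X ⟨x, hx⟩) h1

end Ideles

/-! ### Principal roots of unity and Lagrange resolvents -/

/-- A `p`-th root of unity `z` in a commutative ring in which `p` is invertible, such that the
differences of distinct powers of `z` are invertible as well. In a field, these are the primitive
`p`-th roots of unity. -/
structure IsPrincipalRoot {R : Type u} [CommRing R] (z : R) (p : ℕ) : Prop where
  pow_eq_one : z ^ p = 1
  isUnit_natCast : IsUnit (p : R)
  isUnit_pow_sub_one : ∀ n : ℕ, ¬ p ∣ n → IsUnit (z ^ n - 1)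

namespace IsPrincipalRoot

variable {R : Type u} [CommRing R] {z : R} {p : ℕ}

theorem sum_pow_eq_zero (hz : IsPrincipalRoot z p) {n : ℕ} (hn : ¬ p ∣ n) :
    ∑ i ∈ Finset.range p, (z ^ n) ^ i = 0 := by
  have h := geom_sum_mul (z ^ n) p
  rw [← pow_mul, mul_comm n p, pow_mul, hz.pow_eq_one, one_pow, sub_self] at h
  exact (hz.isUnit_pow_sub_one n hn).mul_left_eq_zero.mp h

theorem mul_pow_pred (hz : IsPrincipalRoot z p) (hp : p ≠ 0) : z * z ^ (p - 1) = 1 := by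
  rw [← pow_succ', Nat.sub_add_cancel (Nat.pos_of_ne_zero hp), hz.pow_eq_one]

theorem of_mul_eq_one (hz : IsPrincipalRoot z p) {w : R} (hzw : z * w = 1) :
    IsPrincipalRoot w p where
  pow_eq_one := by
    have h : (z * w) ^ p = 1 := by rw [hzw, one_pow]
    rwa [mul_pow, hz.pow_eq_one, one_mul] at h
  isUnit_natCast := hz.isUnit_natCast
  isUnit_pow_sub_one n hn := by
    have h : (z * w) ^ n = 1 := by rw [hzw, one_pow]
    rw [mul_pow] at h
    have h2 : w ^ n - 1 = -(w ^ n * (z ^ n - 1)) := by linear_combination h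
    rw [h2]
    exact ((IsUnit.of_mul_eq_one _ ((mul_comm _ _).trans h)).mul
      (hz.isUnit_pow_sub_one n hn)).neg

/-- Orthogonality of the characters `l ↦ z ^ (i l)` of `ℤ / p`. -/
theorem sum_mul_pow (hz : IsPrincipalRoot z p) {w : R} (hzw : z * w = 1) {m i : ℕ} (hm : m < p)
    (hi : i < p) : ∑ l ∈ Finset.range p, (w ^ m * z ^ i) ^ l = if i = m then (p : R) else 0 := by
  have hpow (n : ℕ) : w ^ n * z ^ n = 1 := by rw [← mul_pow, mul_comm, hzw, one_pow]
  split_ifs with h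
  · subst h
    simp [hpow]
  · rcases Nat.lt_or_gt_of_ne h with h | h
    · obtain ⟨j, rfl⟩ := Nat.exists_eq_add_of_lt h
      rw [add_assoc, pow_add, mul_right_comm, hpow, one_mul]
      exact (hz.of_mul_eq_one hzw).sum_pow_eq_zero
        (fun hd => by have := Nat.le_of_dvd (Nat.succ_pos j) hd; omega)
    · obtain ⟨j, rfl⟩ := Nat.exists_eq_add_of_lt h
      rw [add_assoc, pow_add, ← mul_assoc, hpow, one_mul]
      exact hz.sum_pow_eq_zero
        (fun hd => by have := Nat.le_of_dvd (Nat.succ_pos j) hd; omega)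

theorem map (hz : IsPrincipalRoot z p) {S : Type v} [CommRing S] (f : R →+* S) :
    IsPrincipalRoot (f z) p where
  pow_eq_one := by rw [← map_pow, hz.pow_eq_one, map_one]
  isUnit_natCast := by simpa using hz.isUnit_natCast.map f
  isUnit_pow_sub_one n hn := by simpa using (hz.isUnit_pow_sub_one n hn).map f

end IsPrincipalRoot

theorem IsPrimitiveRoot.isPrincipalRoot {k : Type u} [Field k] {ζ : k} {p : ℕ}
    (hζ : IsPrimitiveRoot ζ p) (hp : (p : k) ≠ 0) : IsPrincipalRoot ζ p where
  pow_eq_one := hζ.pow_eq_one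
  isUnit_natCast := hp.isUnit
  isUnit_pow_sub_one n hn := (sub_ne_zero.mpr fun h => hn (hζ.dvd_of_pow_eq_one n h)).isUnit

section Kummer

variable {R : Type u} {S : Type v} {G : Type w} [CommRing R] [CommRing S] [Algebra R S] [Group G]
  [MulSemiringAction G S]

theorem smul_pow_of_smul_eq {g : G} {c : R} {y : S} (hy : g • y = c • y) (n : ℕ) :
    g • y ^ n = c ^ n • y ^ n := by
  rw [smul_pow', hy, _root_.smul_pow]

theorem smul_eq_of_smul_smul_eq {z w : R} (hzw : z * w = 1) {g : G} {y : S}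
    (hy : w • (g • y) = y) : g • y = z • y := by
  conv_rhs => rw [← hy]
  rw [smul_smul, hzw, one_smul]

variable [SMulCommClass G R S]

variable (R S) in
/-- The Lagrange resolvent `s ↦ ∑ i < p, w ^ i g ^ i(s)`. If `g ^ p = 1` and `w ^ p = 1`, its values
are eigenvectors of `g` for the eigenvalue `w⁻¹`. -/
noncomputable def lagrangeResolvent (p : ℕ) (w : R) (g : G) : S →ₗ[R] S :=
  ∑ i ∈ Finset.range p, w ^ i • DistribSMul.toLinearMap R S (g ^ i)

theorem lagrangeResolvent_apply (p : ℕ) (w : R) (g : G) (s : S) :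
    lagrangeResolvent R S p w g s = ∑ i ∈ Finset.range p, w ^ i • (g ^ i • s) := by
  simp [lagrangeResolvent]

theorem smul_smul_lagrangeResolvent {p : ℕ} {w : R} (hw : w ^ p = 1) {g : G} (hg : g ^ p = 1)
    (s : S) : w • (g • lagrangeResolvent R S p w g s) = lagrangeResolvent R S p w g s := by
  have h := Finset.sum_range_succ' (fun i => w ^ i • (g ^ i • s)) p
  rw [Finset.sum_range_succ, hw, hg, pow_zero, pow_zero] at h
  rw [lagrangeResolvent_apply]
  conv_rhs => rw [add_right_cancel h]
  rw [Finset.smul_sum, Finset.smul_sum]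
  refine Finset.sum_congr rfl fun i _ => ?_
  rw [smul_comm g (w ^ i), smul_smul, smul_smul, ← pow_succ', ← pow_succ']

theorem pow_smul_of_smul_eq {g : G} {c : R} {y : S} (hy : g • y = c • y) (n : ℕ) :
    g ^ n • y = c ^ n • y := by
  induction n with
  | zero => simp
  | succ n ih => rw [pow_succ', mul_smul, ih, smul_comm, hy, smul_smul, ← pow_succ]

theorem lagrangeResolvent_of_smul_eq (p : ℕ) (w : R) {g : G} {c : R} {y : S}
    (hy : g • y = c • y) :
    lagrangeResolvent R S p w g y = (∑ i ∈ Finset.range p, (w * c) ^ i) • y := by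
  rw [lagrangeResolvent_apply, Finset.sum_smul]
  refine Finset.sum_congr rfl fun i _ => ?_
  rw [pow_smul_of_smul_eq hy, smul_smul, mul_pow]

theorem lagrangeResolvent_mul_of_smul_eq (p : ℕ) {g : G} {c : R} {y : S}
    (hy : g • y = c • y) (s : S) :
    lagrangeResolvent R S p c g s * y = lagrangeResolvent R S p 1 g (s * y) := by
  rw [lagrangeResolvent_apply, lagrangeResolvent_apply, Finset.sum_mul]
  refine Finset.sum_congr rfl fun i _ => ?_
  rw [smul_mul', pow_smul_of_smul_eq hy, mul_smul_comm, smul_mul_assoc, one_pow, one_smul]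

/-- The eigenspace decomposition: `p` times `s` is the sum of its resolvents. -/
theorem sum_lagrangeResolvent {p : ℕ} {w : R} (hw : IsPrincipalRoot w p) (hp : p ≠ 0) (g : G)
    (s : S) : ∑ j ∈ Finset.range p, lagrangeResolvent R S p (w ^ j) g s = (p : R) • s := by
  simp_rw [lagrangeResolvent_apply]
  rw [Finset.sum_comm]
  simp_rw [← Finset.sum_smul, ← pow_mul, mul_comm _ (_ : ℕ), pow_mul]
  rw [Finset.sum_eq_single 0]
  · simp
  · intro i hi hi0
    rw [hw.sum_pow_eq_zero (fun hd => hi0 (Nat.eq_zero_of_dvd_of_lt hd (Finset.mem_range.mp hi))),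
      zero_smul]
  · intro h
    exact absurd (Finset.mem_range.mpr (Nat.pos_of_ne_zero hp)) h

/-! ### Kummer theory over a commutative ring -/

/-- Every Galois extension has dual bases with respect to the twisted traces: the separability
idempotent `∑ xᵢ ⊗ yᵢ` is sent by `a ⊗ b ↦ a g(b)` to an idempotent `e_g` with
`s e_g = g(s) e_g` for all `s`, which vanishes for `g ≠ 1` since `g` and `1` are strongly
distinct. -/
theorem IsGaloisExtension.exists_dual_bases (h : IsGaloisExtension R S G) :
    ∃ e : Finset (S × S), ∑ i ∈ e, i.1 * i.2 = 1 ∧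
      ∀ g : G, g ≠ 1 → ∑ i ∈ e, i.1 * (g • i.2) = 0 := by
  obtain ⟨e, he1, he⟩ := h.separable
  have hmul (y : S ⊗[R] S) :
      y * e = (Algebra.TensorProduct.lmul' R (S := S) y ⊗ₜ[R] (1 : S)) * e := by
    induction y with
    | zero => simp
    | add a b ha hb => rw [add_mul, ha, hb, ← add_mul, map_add, TensorProduct.add_tmul]
    | tmul a b =>
      have h1 : a ⊗ₜ[R] b = (a ⊗ₜ[R] (1 : S)) * ((1 : S) ⊗ₜ[R] b) := by simp
      rw [h1, mul_assoc, ← he, ← mul_assoc]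
      simp
  have hee : e * e = e := by
    rw [hmul e, he1]
    exact one_mul e
  let φ (g : G) : S ⊗[R] S →ₐ[R] S :=
    Algebra.TensorProduct.lift (AlgHom.id R S) (MulSemiringAction.toAlgHom R S g)
      fun _ _ => Commute.all _ _
  have hφ (g : G) (a b : S) : φ g (a ⊗ₜ b) = a * g • b := by simp [φ]
  obtain ⟨f, hf⟩ := TensorProduct.exists_finset e
  refine ⟨f, ?_, fun g hg => ?_⟩
  · rw [← he1, hf, map_sum]
    simp
  · have hsum : ∑ i ∈ f, i.1 * (g • i.2) = φ g e := by
      rw [hf, map_sum]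
      simp only [hφ]
    rw [hsum]
    by_contra h0
    obtain ⟨s, hs⟩ := h.distinct 1 g hg.symm (φ g e)
      (by rw [IsIdempotentElem, ← map_mul, hee]) h0
    apply hs
    have h1 := congrArg (φ g) (he s)
    rw [map_mul, map_mul, hφ, hφ, smul_one, mul_one, one_mul] at h1
    simpa using h1

/-- A commutative ring has orthogonal selections if every partition of unity `∑ rᵢ = 1` can be
refined to one of the form `∑ cᵢ dᵢ rᵢ = 1` with `cᵢ dⱼ = 0` for `i ≠ j`. Over such rings the
eigenmodules of cyclic Galois extensions, which are invertible modules, are free. -/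
def HasOrthogonalSelections (R : Type u) [CommRing R] : Prop :=
  ∀ (ι : Type u) (s : Finset ι) (r : ι → R), ∑ i ∈ s, r i = 1 →
    ∃ c d : ι → R, (∀ i j, i ≠ j → c i * d j = 0) ∧ ∑ i ∈ s, c i * d i * r i = 1

end Kummer

section KummerUnits

variable {R S : Type u} {G : Type w} [CommRing R] [CommRing S] [Algebra R S] [Group G]
  [MulSemiringAction G S] [SMulCommClass G R S]

theorem smul_eq_of_mem_zpowers {g : G} (hg : ∀ h : G, h ∈ Subgroup.zpowers g) {s : S}
    (hs : g • s = s) (h : G) : h • s = s := by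
  have h1 : Subgroup.zpowers g ≤ MulAction.stabilizer G s := by
    rw [Subgroup.zpowers_le]
    exact hs
  exact h1 (hg h)

/-- A cyclic Galois extension of prime degree of a ring with orthogonal selections contains a unit
`u` with `g(u) = z u`. The dual bases produce eigenvectors `a_i` and `b_i` for the eigenvalues `z`
and `z⁻¹` with `∑ a_i b_i = 1`, and `u` is a combination of the `a_i`. -/
theorem IsGaloisExtension.exists_kummer_unit (h : IsGaloisExtension R S G)
    (hR : HasOrthogonalSelections R) {p : ℕ} (hp : p.Prime) (hG : Nat.card G = p) {z : R}
    (hz : IsPrincipalRoot z p) {g : G} (hg : ∀ h : G, h ∈ Subgroup.zpowers g) :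
    ∃ u : Sˣ, g • (u : S) = z • (u : S) := by
  obtain ⟨e, he1, he⟩ := h.exists_dual_bases
  set w := z ^ (p - 1) with hwdef
  have hzw : z * w = 1 := hz.mul_pow_pred hp.ne_zero
  have hwz : w * z = 1 := (mul_comm _ _).trans hzw
  have hw := hz.of_mul_eq_one hzw
  have hgp : g ^ p = 1 := by rw [← hG]; exact pow_card_eq_one'
  have horder : orderOf g = p := by rw [orderOf_eq_card_of_forall_mem_zpowers hg, hG]
  let X : S × S → S := fun i => lagrangeResolvent R S p w g i.1
  let Y : S × S → S := fun i => lagrangeResolvent R S p z g i.2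
  have hX (i : S × S) : g • X i = z • X i :=
    smul_eq_of_smul_smul_eq hzw (smul_smul_lagrangeResolvent hw.pow_eq_one hgp _)
  have hY (i : S × S) : g • Y i = w • Y i :=
    smul_eq_of_smul_smul_eq hwz (smul_smul_lagrangeResolvent hz.pow_eq_one hgp _)
  have h1 : ∑ i ∈ e, i.1 * Y i = 1 := by
    simp only [Y, lagrangeResolvent_apply, Finset.mul_sum]
    rw [Finset.sum_comm, Finset.sum_eq_single 0]
    · simpa using he1
    · intro l hl hl0
      have hgl : g ^ l ≠ 1 := by
        rw [Ne, ← orderOf_dvd_iff_pow_eq_one, horder]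
        exact fun hd => hl0 (Nat.eq_zero_of_dvd_of_lt hd (Finset.mem_range.mp hl))
      simp only [mul_smul_comm]
      rw [← Finset.smul_sum, he _ hgl, smul_zero]
    · intro h0
      exact absurd (Finset.mem_range.mpr hp.pos) h0
  have h2 : ∑ i ∈ e, X i * Y i = (p : S) := by
    simp only [X, lagrangeResolvent_mul_of_smul_eq p (hY _)]
    rw [← map_sum, h1, lagrangeResolvent_apply]
    simp
  have hfix (i : S × S) : ∃ r : R, algebraMap R S r = X i * Y i := by
    refine h.fixed _ (smul_eq_of_mem_zpowers hg ?_)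
    rw [smul_mul', hX, hY, smul_mul_smul_comm, hzw, one_smul]
  choose r hr using hfix
  obtain ⟨q, hq⟩ := hz.isUnit_natCast.exists_left_inv
  obtain ⟨c, d, hcd, hsum⟩ := hR (S × S) e (fun i => q * r i) (by
    apply h.injective
    rw [map_sum]
    simp only [map_mul, hr]
    rw [← Finset.mul_sum, h2, ← map_natCast (algebraMap R S), ← map_mul, hq])
  have huv : (∑ i ∈ e, c i • X i) * (∑ j ∈ e, (d j * q) • Y j) = 1 := by
    rw [Finset.sum_mul_sum, ← map_one (algebraMap R S), ← hsum, map_sum]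
    refine Finset.sum_congr rfl fun i hi => ?_
    rw [Finset.sum_eq_single_of_mem i hi]
    · rw [smul_mul_smul_comm, ← hr, Algebra.smul_def, ← map_mul]
      congr 1
      ring
    · intro j _ hji
      rw [smul_mul_smul_comm, ← mul_assoc, hcd i j hji.symm, zero_mul, zero_smul]
  refine ⟨Units.mkOfMulEqOne _ _ huv, ?_⟩
  rw [Units.val_mkOfMulEqOne, Finset.smul_sum, Finset.smul_sum]
  refine Finset.sum_congr rfl fun i _ => ?_
  rw [smul_comm, hX, smul_comm]

variable {p : ℕ} {z : R} {g : G} {u : Sˣ}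

theorem IsGaloisExtension.exists_unit_eq_of_smul_eq (h : IsGaloisExtension R S G)
    (hg : ∀ h : G, h ∈ Subgroup.zpowers g) (hu : g • (u : S) = u) :
    ∃ t : Rˣ, algebraMap R S t = u := by
  obtain ⟨a, ha⟩ := h.fixed _ (smul_eq_of_mem_zpowers hg hu)
  obtain ⟨b, hb⟩ := h.fixed ((u⁻¹ : Sˣ) : S) (smul_eq_of_mem_zpowers hg (by
    have h1 : (u : S) * (g • ((u⁻¹ : Sˣ) : S)) = 1 := by
      conv_lhs => rw [← hu]
      rw [← smul_mul', Units.mul_inv, smul_one]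
    exact (Units.mul_eq_one_iff_inv_eq.mp h1).symm))
  refine ⟨Units.mkOfMulEqOne a b (h.injective ?_), ha⟩
  rw [map_mul, ha, hb, Units.mul_inv, map_one]

theorem IsGaloisExtension.exists_unit_eq_pow (h : IsGaloisExtension R S G)
    (hz : IsPrincipalRoot z p) (hg : ∀ h : G, h ∈ Subgroup.zpowers g)
    (hu : g • (u : S) = z • (u : S)) : ∃ t : Rˣ, algebraMap R S t = (u : S) ^ p := by
  refine h.exists_unit_eq_of_smul_eq (u := u ^ p) hg ?_
  rw [Units.val_pow_eq_pow_val, smul_pow_of_smul_eq hu, hz.pow_eq_one, one_smul]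

/-- The powers of a Kummer unit span the extension. -/
theorem IsGaloisExtension.exists_eq_sum_pow (h : IsGaloisExtension R S G)
    (hp : p ≠ 0) (hG : Nat.card G = p) (hz : IsPrincipalRoot z p)
    (hg : ∀ h : G, h ∈ Subgroup.zpowers g) (hu : g • (u : S) = z • (u : S)) (s : S) :
    ∃ c : ℕ → R, s = ∑ i ∈ Finset.range p, c i • (u : S) ^ i := by
  have hzw := hz.mul_pow_pred hp
  set w := z ^ (p - 1)
  have hw := hz.of_mul_eq_one hzw
  have hgp : g ^ p = 1 := by rw [← hG]; exact pow_card_eq_one'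
  have key (i : ℕ) : ∃ r : R, lagrangeResolvent R S p (w ^ i) g s = r • (u : S) ^ i := by
    have hL : g • lagrangeResolvent R S p (w ^ i) g s =
        z ^ i • lagrangeResolvent R S p (w ^ i) g s :=
      smul_eq_of_smul_smul_eq (by rw [← mul_pow, hzw, one_pow])
        (smul_smul_lagrangeResolvent
          (by rw [← pow_mul, mul_comm, pow_mul, hw.pow_eq_one, one_pow]) hgp s)
    have hui : (u : S) * (g • ((u⁻¹ : Sˣ) : S)) = w • (1 : S) := by
      rw [← one_smul R (u : S), ← hzw, mul_comm z w, mul_smul, ← hu, smul_mul_assoc, ← smul_mul',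
        Units.mul_inv, smul_one]
    have hui' : g • ((u⁻¹ : Sˣ) : S) = w • ((u⁻¹ : Sˣ) : S) := by
      rw [← Units.mul_right_inj u, hui, mul_smul_comm, Units.mul_inv]
    obtain ⟨r, hr⟩ := h.fixed (lagrangeResolvent R S p (w ^ i) g s * ((u⁻¹ : Sˣ) : S) ^ i)
      (smul_eq_of_mem_zpowers hg (by
        rw [smul_mul', hL, smul_pow_of_smul_eq hui', smul_mul_smul_comm, ← mul_pow, hzw, one_pow,
          one_smul]))
    refine ⟨r, ?_⟩
    rw [Algebra.smul_def, hr, mul_assoc, ← mul_pow, Units.inv_mul, one_pow, mul_one]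
  choose r hr using key
  obtain ⟨q, hq⟩ := hz.isUnit_natCast.exists_left_inv
  refine ⟨fun i => q * r i, ?_⟩
  simp only [mul_smul, ← hr]
  rw [← Finset.smul_sum, sum_lagrangeResolvent hw hp, smul_smul, hq, one_smul]

/-- The resolvents extract the coefficients of a combination of powers of a Kummer unit. -/
theorem lagrangeResolvent_sum_pow (hz : IsPrincipalRoot z p) {w : R} (hzw : z * w = 1)
    (hu : g • (u : S) = z • (u : S)) (c : ℕ → R) {m : ℕ} (hm : m < p) :
    lagrangeResolvent R S p (w ^ m) g (∑ i ∈ Finset.range p, c i • (u : S) ^ i) =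
      ((p : R) * c m) • (u : S) ^ m := by
  rw [map_sum, Finset.sum_eq_single_of_mem m (Finset.mem_range.mpr hm)]
  · rw [map_smul, lagrangeResolvent_of_smul_eq p _ (smul_pow_of_smul_eq hu m),
      hz.sum_mul_pow hzw hm hm, if_pos rfl, smul_smul, mul_comm]
  · intro i hi him
    rw [map_smul, lagrangeResolvent_of_smul_eq p _ (smul_pow_of_smul_eq hu i),
      hz.sum_mul_pow hzw hm (Finset.mem_range.mp hi), if_neg him, zero_smul, smul_zero]

theorem eq_zero_of_sum_pow_eq_zero (hinj : Function.Injective (algebraMap R S)) (hp : p ≠ 0)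
    (hz : IsPrincipalRoot z p) (hu : g • (u : S) = z • (u : S)) {c : ℕ → R}
    (hc : ∑ i ∈ Finset.range p, c i • (u : S) ^ i = 0) {m : ℕ} (hm : m < p) : c m = 0 := by
  have h := lagrangeResolvent_sum_pow hz (hz.mul_pow_pred hp) hu c hm
  rw [hc, map_zero, Algebra.smul_def, ← Units.val_pow_eq_pow_val, eq_comm,
    Units.mul_left_eq_zero] at h
  exact hz.isUnit_natCast.mul_right_eq_zero.mp (hinj (h.trans (map_zero _).symm))

end KummerUnits

/-! ### The algebras `R[T] / (T ^ p - t)` -/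

section AdjoinRoot

variable {R S : Type u} [CommRing R] [CommRing S] [Algebra R S]

theorem adjoinRoot_root_pow (p : ℕ) (t : R) :
    (AdjoinRoot.root (Polynomial.X ^ p - Polynomial.C t)) ^ p = algebraMap R _ t := by
  have h := AdjoinRoot.eval₂_root (Polynomial.X ^ p - Polynomial.C t)
  simpa [sub_eq_zero] using h

theorem adjoinRoot_exists_eq_sum_pow {p : ℕ} (hp : p ≠ 0) (t : R)
    (x : AdjoinRoot (Polynomial.X ^ p - Polynomial.C t)) :
    ∃ c : ℕ → R, x = ∑ i ∈ Finset.range p, c i • AdjoinRoot.root _ ^ i := by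
  rcases subsingleton_or_nontrivial R with _ | _
  · have := (algebraMap R (AdjoinRoot (Polynomial.X ^ p - Polynomial.C t))).codomain_trivial
    exact ⟨0, Subsingleton.elim _ _⟩
  have hm : (Polynomial.X ^ p - Polynomial.C t).Monic := Polynomial.monic_X_pow_sub_C t hp
  obtain ⟨q, rfl⟩ := AdjoinRoot.mk_surjective x
  set r := q %ₘ (Polynomial.X ^ p - Polynomial.C t) with hr
  have hqr : AdjoinRoot.mk (Polynomial.X ^ p - Polynomial.C t) q = AdjoinRoot.mk _ r :=
    (AdjoinRoot.mk_leftInverse hm _).symm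
  have hd : r.natDegree < p := by
    have h1 := Polynomial.natDegree_modByMonic_lt q hm (by
      intro h
      have h2 := congrArg Polynomial.natDegree h
      rw [Polynomial.natDegree_X_pow_sub_C, Polynomial.natDegree_one] at h2
      exact hp h2)
    rwa [Polynomial.natDegree_X_pow_sub_C] at h1
  refine ⟨r.coeff, ?_⟩
  rw [hqr]
  conv_lhs => rw [r.as_sum_range' p hd]
  rw [map_sum]
  refine Finset.sum_congr rfl fun i _ => ?_
  rw [← Polynomial.C_mul_X_pow_eq_monomial, map_mul, map_pow, AdjoinRoot.mk_C, AdjoinRoot.mk_X,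
    Algebra.smul_def]
  rfl

theorem adjoinRoot_algebraMap_injective [Nontrivial R] {p : ℕ} (hp : p ≠ 0) (t : R) :
    Function.Injective (algebraMap R (AdjoinRoot (Polynomial.X ^ p - Polynomial.C t))) := by
  rw [injective_iff_map_eq_zero]
  intro a ha
  by_contra ha0
  refine (Polynomial.monic_X_pow_sub_C t hp).not_dvd_of_natDegree_lt
    (Polynomial.C_ne_zero.mpr ha0) ?_ (AdjoinRoot.mk_eq_zero.mp ((AdjoinRoot.mk_C a).trans ha))
  rw [Polynomial.natDegree_C, Polynomial.natDegree_X_pow_sub_C]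
  exact Nat.pos_of_ne_zero hp

theorem mem_zpowers_ofAdd_one {p : ℕ} (a : CyclicGroup p) :
    a ∈ Subgroup.zpowers (Multiplicative.ofAdd (1 : ZMod p)) := by
  obtain ⟨n, hn⟩ := ZMod.intCast_surjective a.toAdd
  refine ⟨n, ?_⟩
  change Multiplicative.ofAdd (1 : ZMod p) ^ n = a
  rw [← ofAdd_zsmul, zsmul_one, hn, ofAdd_toAdd]

/-- The homomorphism `R[T] / (T ^ p - t) → S` given by a `p`-th root of `t` in `S`. -/
noncomputable def adjoinRootHom (p : ℕ) (t : R) (s : S) (hs : s ^ p = algebraMap R S t) :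
    AdjoinRoot (Polynomial.X ^ p - Polynomial.C t) →ₐ[R] S :=
  AdjoinRoot.liftAlgHom _ (Algebra.ofId R S) s (by
    rw [Polynomial.eval₂_sub, Polynomial.eval₂_X_pow, Polynomial.eval₂_C, hs]
    exact sub_self _)

theorem adjoinRootHom_root (p : ℕ) (t : R) (s : S) (hs : s ^ p = algebraMap R S t) :
    adjoinRootHom p t s hs (AdjoinRoot.root _) = s :=
  AdjoinRoot.liftAlgHom_root ..

variable {G : Type w} [Group G] [MulSemiringAction G S] [SMulCommClass G R S]
variable {p : ℕ} {z : R} {g : G} {u : Sˣ} {t : R}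

/-- A cyclic Galois extension with Kummer unit `u` is `R[T] / (T ^ p - u ^ p)`. -/
theorem IsGaloisExtension.exists_adjoinRoot_algEquiv (h : IsGaloisExtension R S G)
    (hp : p ≠ 0) (hG : Nat.card G = p) (hz : IsPrincipalRoot z p)
    (hg : ∀ h : G, h ∈ Subgroup.zpowers g) (hu : g • (u : S) = z • (u : S))
    (ht : algebraMap R S t = (u : S) ^ p) :
    ∃ e : AdjoinRoot (Polynomial.X ^ p - Polynomial.C t) ≃ₐ[R] S, e (AdjoinRoot.root _) = u := by
  let f := adjoinRootHom p t (u : S) ht.symm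
  have hf : f (AdjoinRoot.root _) = u := adjoinRootHom_root ..
  refine ⟨AlgEquiv.ofBijective f ⟨?_, fun s => ?_⟩, hf⟩
  · rw [injective_iff_map_eq_zero]
    intro x hx
    obtain ⟨c, rfl⟩ := adjoinRoot_exists_eq_sum_pow hp t x
    simp only [map_sum, map_smul, map_pow, hf] at hx
    refine Finset.sum_eq_zero fun i hi => ?_
    rw [eq_zero_of_sum_pow_eq_zero h.injective hp hz hu hx (Finset.mem_range.mp hi), zero_smul]
  · obtain ⟨c, rfl⟩ := h.exists_eq_sum_pow hp hG hz hg hu s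
    exact ⟨∑ i ∈ Finset.range p, c i • AdjoinRoot.root _ ^ i, by
      simp only [map_sum, map_smul, map_pow, hf]⟩

/-- An action of a cyclic group of prime order `p` is Galois as soon as there is a unit `u` with
`g(u) = z u` whose powers span the ring. The separability idempotent is
`p⁻¹ ∑ uⁱ ⊗ u⁻ⁱ`. -/
theorem isGaloisExtension_of_kummer_unit [Nontrivial S] (hinj : Function.Injective (algebraMap R S))
    (hp : p.Prime) (hG : Nat.card G = p) (hz : IsPrincipalRoot z p)
    (hg : ∀ h : G, h ∈ Subgroup.zpowers g) (hu : g • (u : S) = z • (u : S))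
    (ht : algebraMap R S t = (u : S) ^ p)
    (hspan : ∀ s : S, ∃ c : ℕ → R, s = ∑ i ∈ Finset.range p, c i • (u : S) ^ i) :
    IsGaloisExtension R S G := by
  have hfin : Finite G := Nat.finite_of_card_ne_zero (hG ▸ hp.ne_zero)
  have horder : orderOf g = p := by rw [orderOf_eq_card_of_forall_mem_zpowers hg, hG]
  have hpow (h : G) : ∃ n < p, g ^ n = h := by
    obtain ⟨n, rfl⟩ := (isOfFinOrder_of_finite g).mem_powers_iff_mem_zpowers.mpr (hg h)
    exact ⟨n % p, Nat.mod_lt _ hp.pos, by rw [← horder]; exact pow_mod_orderOf g n⟩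
  obtain ⟨q, hq⟩ := hz.isUnit_natCast.exists_left_inv
  -- Distinct elements of the group act on `u` by scalars with invertible difference.
  have hdist (a b : G) (hab : a ≠ b) : ∃ c : R, IsUnit c ∧ a • (u : S) - b • (u : S) = c • u := by
    obtain ⟨m, hm, rfl⟩ := hpow a
    obtain ⟨n, hn, rfl⟩ := hpow b
    refine ⟨z ^ m - z ^ n, ?_, by rw [pow_smul_of_smul_eq hu, pow_smul_of_smul_eq hu, sub_smul]⟩
    have hzu (i : ℕ) : IsUnit (z ^ i) :=
      (IsUnit.of_mul_eq_one _ (hz.mul_pow_pred hp.ne_zero)).pow i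
    have hmn : m ≠ n := by rintro rfl; exact hab rfl
    rcases Nat.lt_or_gt_of_ne hmn with h | h
    · obtain ⟨j, rfl⟩ := Nat.exists_eq_add_of_lt h
      have h1 : z ^ m - z ^ (m + j + 1) = -(z ^ m * (z ^ (j + 1) - 1)) := by ring
      rw [h1]
      exact ((hzu m).mul (hz.isUnit_pow_sub_one _
        (fun hd => by have := Nat.le_of_dvd (Nat.succ_pos j) hd; omega))).neg
    · obtain ⟨j, rfl⟩ := Nat.exists_eq_add_of_lt h
      have h1 : z ^ (n + j + 1) - z ^ n = z ^ n * (z ^ (j + 1) - 1) := by ring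
      rw [h1]
      exact (hzu n).mul (hz.isUnit_pow_sub_one _
        (fun hd => by have := Nat.le_of_dvd (Nat.succ_pos j) hd; omega))
  have hunit {c : R} (hc : IsUnit c) : IsUnit (c • (u : S)) := by
    rw [Algebra.smul_def]
    exact (hc.map _).mul u.isUnit
  refine ⟨hfin, hinj, ⟨fun {a b} hab => ?_⟩, fun s hs => ?_, ?_, fun a b hab e he he0 => ?_⟩
  · by_contra hne
    obtain ⟨c, hc, hcu⟩ := hdist a b hne
    rw [hab, sub_self] at hcu
    exact (hunit hc).ne_zero hcu.symm
  · obtain ⟨c, rfl⟩ := hspan s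
    have h1 := lagrangeResolvent_sum_pow hz (hz.mul_pow_pred hp.ne_zero) hu c hp.pos
    rw [pow_zero, lagrangeResolvent_apply] at h1
    simp only [hs, one_pow, one_smul, Finset.sum_const, Finset.card_range, pow_zero] at h1
    refine ⟨c 0, ?_⟩
    have h2 := congrArg (q • ·) h1
    rw [← Nat.cast_smul_eq_nsmul R, smul_smul, smul_smul, ← mul_assoc, hq, one_mul, one_smul] at h2
    rw [h2, Algebra.algebraMap_eq_smul_one]
  · have huinv : ((u⁻¹ : Sˣ) : S) ^ p * algebraMap R S t = 1 := by
      rw [ht, ← mul_pow, Units.inv_mul, one_pow]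
    -- The summand for the index `p` agrees with that for the index `0`.
    have hper : ((u : S) ^ p) ⊗ₜ[R] (((u⁻¹ : Sˣ) : S) ^ p) = (1 : S) ⊗ₜ[R] (1 : S) := by
      rw [← ht, Algebra.algebraMap_eq_smul_one, TensorProduct.smul_tmul, Algebra.smul_def,
        mul_comm, huinv]
    let e : S ⊗[R] S := ∑ i ∈ Finset.range p, ((u : S) ^ i) ⊗ₜ[R] (((u⁻¹ : Sˣ) : S) ^ i)
    have hshift : e = ∑ i ∈ Finset.range p,
        ((u : S) ^ (i + 1)) ⊗ₜ[R] (((u⁻¹ : Sˣ) : S) ^ (i + 1)) := by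
      have h := Finset.sum_range_succ'
        (fun i => ((u : S) ^ i) ⊗ₜ[R] (((u⁻¹ : Sˣ) : S) ^ i)) p
      rw [Finset.sum_range_succ, hper, pow_zero, pow_zero] at h
      exact add_right_cancel h
    have heu : ((u : S) ⊗ₜ[R] (1 : S)) * e = ((1 : S) ⊗ₜ[R] (u : S)) * e := by
      conv_rhs => rw [hshift]
      simp only [e, Finset.mul_sum, Algebra.TensorProduct.tmul_mul_tmul, one_mul]
      refine Finset.sum_congr rfl fun i _ => ?_
      rw [← pow_succ', pow_succ' ((u⁻¹ : Sˣ) : S), ← mul_assoc, Units.mul_inv, one_mul]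
    have hepow (n : ℕ) : (((u : S) ^ n) ⊗ₜ[R] (1 : S)) * e = ((1 : S) ⊗ₜ[R] ((u : S) ^ n)) * e := by
      induction n with
      | zero => simp
      | succ n ih =>
        have h1 : ((u : S) ^ (n + 1)) ⊗ₜ[R] (1 : S) =
            ((u : S) ⊗ₜ[R] (1 : S)) * (((u : S) ^ n) ⊗ₜ[R] (1 : S)) := by
          rw [Algebra.TensorProduct.tmul_mul_tmul, one_mul, pow_succ']
        have h2 : (1 : S) ⊗ₜ[R] ((u : S) ^ (n + 1)) =
            ((1 : S) ⊗ₜ[R] ((u : S) ^ n)) * ((1 : S) ⊗ₜ[R] (u : S)) := by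
          rw [Algebra.TensorProduct.tmul_mul_tmul, one_mul, pow_succ]
        rw [h1, h2, mul_assoc, ih, mul_assoc, ← heu, mul_left_comm]
    refine ⟨q • e, ?_, fun s => ?_⟩
    · rw [map_smul, map_sum]
      simp only [Algebra.TensorProduct.lmul'_apply_tmul, ← mul_pow, Units.mul_inv, one_pow,
        Finset.sum_const, Finset.card_range]
      rw [← Nat.cast_smul_eq_nsmul R, smul_smul, hq, one_smul]
    · obtain ⟨c, rfl⟩ := hspan s
      simp only [TensorProduct.sum_tmul, TensorProduct.tmul_sum, Finset.sum_mul]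
      refine Finset.sum_congr rfl fun i _ => ?_
      rw [← TensorProduct.smul_tmul', TensorProduct.tmul_smul, mul_smul_comm, mul_smul_comm,
        smul_mul_assoc, smul_mul_assoc, hepow]
  · by_contra hne
    push Not at hne
    obtain ⟨c, hc, hcu⟩ := hdist a b hab
    apply he0
    have h1 : a • (u : S) * e = b • (u : S) * e := hne u
    rw [← sub_eq_zero, ← sub_mul, hcu] at h1
    exact (hunit hc).mul_right_eq_zero.mp h1

/-- The cyclic group of order `p` acts on `R[T] / (T ^ p - t)`, the generator sending `T` to `z T`,
and `R[T] / (T ^ p - t)` is a Galois extension with Kummer unit `T`. -/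
theorem exists_galoisExtension_kummer_unit [Nontrivial R] (hp : p.Prime)
    (hz : IsPrincipalRoot z p) (t : Rˣ) :
    ∃ (E : GaloisExtension R (CyclicGroup p)) (u : E.Sˣ),
      (Multiplicative.ofAdd (1 : ZMod p)) • (u : E.S) = z • (u : E.S) ∧
        algebraMap R E.S t = (u : E.S) ^ p := by
  let S := AdjoinRoot (Polynomial.X ^ p - Polynomial.C (t : R))
  have hinj : Function.Injective (algebraMap R S) := adjoinRoot_algebraMap_injective hp.ne_zero _
  have : Nontrivial S := hinj.nontrivial
  let T : S := AdjoinRoot.root _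
  have hT : T ^ p = algebraMap R S t := adjoinRoot_root_pow p (t : R)
  have hTu : IsUnit T := by
    rw [← isUnit_pow_iff hp.ne_zero, hT]
    exact t.isUnit.map _
  have hzw := hz.mul_pow_pred hp.ne_zero
  set w := z ^ (p - 1)
  have hcT (c : R) (hc : c ^ p = 1) : (c • T) ^ p = algebraMap R S t := by
    rw [_root_.smul_pow, hc, one_smul, hT]
  let f : S →ₐ[R] S := adjoinRootHom p (t : R) (z • T) (hcT z hz.pow_eq_one)
  let f' : S →ₐ[R] S := adjoinRootHom p (t : R) (w • T) (hcT w (hz.of_mul_eq_one hzw).pow_eq_one)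
  have hf : f T = z • T := adjoinRootHom_root ..
  have hf' : f' T = w • T := adjoinRootHom_root ..
  let σ : S ≃ₐ[R] S := AlgEquiv.ofAlgHom f f'
    (AdjoinRoot.algHom_ext (by
      change f (f' T) = T
      rw [hf', map_smul, hf, smul_smul, mul_comm, hzw, one_smul]))
    (AdjoinRoot.algHom_ext (by
      change f' (f T) = T
      rw [hf, map_smul, hf', smul_smul, hzw, one_smul]))
  have hσ (n : ℕ) : (σ ^ n) T = z ^ n • T := by
    induction n with
    | zero => simp
    | succ n ih =>
      rw [pow_succ', AlgEquiv.mul_apply, ih, map_smul, pow_succ, mul_smul]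
      exact congrArg _ hf
  have hσp : σ ^ p = 1 := by
    refine AlgEquiv.coe_toAlgHom_injective (AdjoinRoot.algHom_ext ?_)
    change (σ ^ p) T = T
    rw [hσ, hz.pow_eq_one, one_smul]
  let ρ : CyclicGroup p →* (S ≃ₐ[R] S) := AddMonoidHom.toMultiplicativeLeft
    (ZMod.lift p ⟨zmultiplesHom (Additive (S ≃ₐ[R] S)) (Additive.ofMul σ), by
      rw [zmultiplesHom_apply, natCast_zsmul, ← ofMul_pow, hσp, ofMul_one]⟩)
  have hρ : ρ (Multiplicative.ofAdd 1) = σ := by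
    have h : (1 : ZMod p) = ((1 : ℤ) : ZMod p) := by simp
    rw [h]
    change Additive.toMul (ZMod.lift p _ _) = σ
    exact congrArg Additive.toMul ((ZMod.lift_coe p _ 1).trans (one_zsmul _))
  let _ : MulSemiringAction (CyclicGroup p) S := MulSemiringAction.compHom S ρ
  have hρs (a : CyclicGroup p) (s : S) : a • s = ρ a s := rfl
  have : SMulCommClass (CyclicGroup p) R S := ⟨fun a r s => by
    rw [hρs, hρs, map_smul]⟩
  have hgal : IsGaloisExtension R S (CyclicGroup p) :=
    isGaloisExtension_of_kummer_unit (u := hTu.unit) (g := Multiplicative.ofAdd 1) (t := (t : R))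
      hinj hp ((Nat.card_congr Multiplicative.toAdd).trans (Nat.card_zmod p)) hz
      mem_zpowers_ofAdd_one
      (by rw [IsUnit.unit_spec, hρs, hρ]; exact hf)
      (by rw [IsUnit.unit_spec, hT])
      (fun s => by rw [IsUnit.unit_spec]; exact adjoinRoot_exists_eq_sum_pow hp.ne_zero _ s)
  exact ⟨⟨S, hgal⟩, hTu.unit, by rw [IsUnit.unit_spec]; exact (congrArg (· T) hρ).trans hf,
    by rw [IsUnit.unit_spec]; exact hT.symm⟩

end AdjoinRoot

/-! ### Cyclic extensions with and without a chosen group -/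

section Harrison

variable {R : Type u} [CommRing R]

/-- Transport of a Galois extension along an isomorphism of groups. -/
theorem GaloisExtension.exists_conjugate {G : Type v} {H : Type w} [Group G] [Group H]
    (E : GaloisExtension R G) (e : H ≃* G) : ∃ E' : GaloisExtension R H, E'.Conjugate E := by
  let _ : MulSemiringAction H E.S := MulSemiringAction.compHom E.S e.toMonoidHom
  have hsmul (h : H) (s : E.S) : h • s = e h • s := rfl
  have : SMulCommClass H R E.S := ⟨fun h r s => smul_comm (e h) r s⟩
  have hgal : IsGaloisExtension R E.S H :=
    { finite := have := E.isGalois.finite; Finite.of_equiv G e.symm.toEquiv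
      injective := E.isGalois.injective
      faithful := ⟨fun {a b} hab => e.injective (E.isGalois.faithful.eq_of_smul_eq_smul hab)⟩
      fixed := fun s hs => E.isGalois.fixed s fun g => by
        rw [← e.apply_symm_apply g]
        exact hs (e.symm g)
      separable := E.isGalois.separable
      distinct := fun a b hab => E.isGalois.distinct (e a) (e b) (e.injective.ne hab) }
  exact ⟨⟨E.S, hgal⟩, AlgEquiv.refl, e, fun _ _ => rfl⟩

/-- Conjugacy classes of `p`-cyclic extensions are orbits of `Aut(C_p)` on the Harrison group:
every group of order `p` is isomorphic to `C_p`, and the group component of a conjugacy between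
`C_p`-extensions is an automorphism of `C_p`. -/
theorem exists_harrison_orbits_equiv_conjugacyClasses (R : Type u) [CommRing R] (p : ℕ)
    [hp : Fact p.Prime] :
    ∃ Φ : MulAction.orbitRel.Quotient (MulAut (CyclicGroup p)) (Harrison R (CyclicGroup p)) ≃
        ConjugacyClasses R p,
      ∀ E : GaloisExtension R (CyclicGroup p),
        Φ (Quotient.mk _ (Harrison.mk E)) = ConjugacyClasses.mk E.toPCyclic := by
  let F : Harrison R (CyclicGroup p) → ConjugacyClasses R p :=
    Quotient.lift (fun E => ConjugacyClasses.mk E.toPCyclic)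
      fun E₁ E₂ ⟨φ, hφ⟩ => Quotient.sound ⟨φ, MulEquiv.refl _, hφ⟩
  have hF (τ : MulAut (CyclicGroup p)) (c : Harrison R (CyclicGroup p)) : F (τ • c) = F c := by
    induction c using Quotient.inductionOn with
    | h E => exact Quotient.sound ⟨AlgEquiv.refl, (τ⁻¹ : MulAut (CyclicGroup p)), fun _ _ => rfl⟩
  let F' : MulAction.orbitRel.Quotient (MulAut (CyclicGroup p)) (Harrison R (CyclicGroup p)) →
      ConjugacyClasses R p := Quotient.lift F (by
    rintro a b ⟨τ, rfl⟩
    exact hF τ b)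
  refine ⟨Equiv.ofBijective F' ⟨?_, ?_⟩, fun E => rfl⟩
  · intro a b hab
    induction a using Quotient.inductionOn with
    | h a =>
    induction b using Quotient.inductionOn with
    | h b =>
    induction a using Quotient.inductionOn with
    | h E₁ =>
    induction b using Quotient.inductionOn with
    | h E₂ =>
    obtain ⟨φ, τ, h⟩ := Quotient.exact hab
    let τ' : MulAut (CyclicGroup p) := τ
    refine Quotient.sound ⟨τ'⁻¹, Quotient.sound ?_⟩
    exact Setoid.symm (a := E₁) (b := E₂.twist τ'⁻¹⁻¹) ⟨φ, h⟩
  · intro c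
    induction c using Quotient.inductionOn with
    | h P =>
    obtain ⟨E, hE⟩ := P.ext.exists_conjugate (mulEquivOfPrimeCardEq (p := p)
      ((Nat.card_congr Multiplicative.toAdd).trans (Nat.card_zmod p)) P.card_eq)
    exact ⟨Quotient.mk _ (Harrison.mk E), Quotient.sound hE⟩

end Harrison

/-! ### Kummer parameters -/

section KummerParameter

variable {R : Type u} [CommRing R] {G : Type v} {H : Type w} [Group G] [Group H] {p : ℕ} {z : R}

/-- The unit `t` of `R` is a Kummer parameter of the Galois extension `(S, G)` with respect to the
generator `g` of `G` and the root of unity `z`: there is a unit `u` of `S` with `g(u) = z u` and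
`u ^ p = t`. -/
def IsKummerParameter (p : ℕ) (z : R) (E : GaloisExtension R G) (g : G) (t : Rˣ) : Prop :=
  (∀ h : G, h ∈ Subgroup.zpowers g) ∧
    ∃ u : E.Sˣ, g • (u : E.S) = z • (u : E.S) ∧ algebraMap R E.S t = (u : E.S) ^ p

theorem exists_isKummerParameter (hR : HasOrthogonalSelections R) (hp : p.Prime)
    (hz : IsPrincipalRoot z p) (E : GaloisExtension R G) (hG : Nat.card G = p) {g : G}
    (hg : ∀ h : G, h ∈ Subgroup.zpowers g) : ∃ t : Rˣ, IsKummerParameter p z E g t := by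
  obtain ⟨u, hu⟩ := E.isGalois.exists_kummer_unit hR hp hG hz hg
  obtain ⟨t, ht⟩ := E.isGalois.exists_unit_eq_pow hz hg hu
  exact ⟨t, hg, u, hu, ht⟩

namespace IsKummerParameter

variable {E : GaloisExtension R G} {E' : GaloisExtension R H} {g : G} {g' : H} {t t' : Rˣ}

theorem pow (h : IsKummerParameter p z E g t) (m : ℕ) :
    IsKummerParameter p (z ^ m) E g (t ^ m) := by
  obtain ⟨hg, u, hu, ht⟩ := h
  refine ⟨hg, u ^ m, ?_, ?_⟩
  · rw [Units.val_pow_eq_pow_val, smul_pow_of_smul_eq hu]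
  · rw [Units.val_pow_eq_pow_val, Units.val_pow_eq_pow_val, map_pow, ht, ← pow_mul, ← pow_mul,
      mul_comm]

/-- Replacing the generator `g` by `g ^ i` replaces `t` by `t ^ m` with `i m ≡ 1` modulo `p`. -/
theorem generator_pow (h : IsKummerParameter p z E g t) (hz : z ^ p = 1) (hG : Nat.card G = p)
    {i m : ℕ} (him : i * m ≡ 1 [MOD p]) : IsKummerParameter p z E (g ^ i) (t ^ m) := by
  obtain ⟨hg, u, hu, ht⟩ := h.pow m
  have hgi : (g ^ i) ^ m = g := by
    have hgp : orderOf g = p := by rw [orderOf_eq_card_of_forall_mem_zpowers hg, hG]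
    conv_rhs => rw [← pow_one g]
    rw [← pow_mul, pow_eq_pow_iff_modEq, hgp]
    exact him
  refine ⟨fun a => ?_, u, ?_, ht⟩
  · have h1 : Subgroup.zpowers g ≤ Subgroup.zpowers (g ^ i) := by
      rw [Subgroup.zpowers_le]
      exact ⟨m, by simpa using hgi⟩
    exact h1 (hg a)
  · rw [pow_smul_of_smul_eq hu, ← pow_mul, mul_comm, pow_eq_pow_of_modEq him hz, pow_one]

theorem mul_pow (h : IsKummerParameter p z E g t) (r : Rˣ) :
    IsKummerParameter p z E g (t * r ^ p) := by
  obtain ⟨hg, u, hu, ht⟩ := h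
  refine ⟨hg, u * Units.map (algebraMap R E.S).toMonoidHom r, ?_, ?_⟩
  · change g • ((u : E.S) * algebraMap R E.S r) = z • ((u : E.S) * algebraMap R E.S r)
    rw [smul_mul', hu, smul_algebraMap, smul_mul_assoc]
  · change _ = ((u : E.S) * algebraMap R E.S r) ^ p
    rw [_root_.mul_pow, ← ht, Units.val_mul, map_mul, Units.val_pow_eq_pow_val, map_pow]

theorem of_conjugate {φ : E.S ≃ₐ[R] E'.S} {τ : G ≃* H}
    (hφ : ∀ (g : G) (s : E.S), φ (g • s) = τ g • φ s) (h : IsKummerParameter p z E g t) :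
    IsKummerParameter p z E' (τ g) t := by
  obtain ⟨hg, u, hu, ht⟩ := h
  refine ⟨fun a => ?_, Units.map φ.toAlgHom.toRingHom.toMonoidHom u, ?_, ?_⟩
  · obtain ⟨n, hn⟩ := hg (τ.symm a)
    exact ⟨n, by rw [← τ.apply_symm_apply a, ← hn]; exact (map_zpow τ g n).symm⟩
  · change τ g • φ u = z • φ u
    rw [← hφ, hu, map_smul]
  · change _ = (φ u) ^ p
    rw [← map_pow, ← ht, AlgEquiv.commutes]

/-- Two Kummer parameters of one extension, for the generators `g` and `g ^ i` and the roots of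
unity `z` and `z ^ j`, are related by `t' ^ i = t ^ j` up to `p`-th powers. -/
theorem pow_eq_pow_mul_pow {i j : ℕ} (h : IsKummerParameter p z E g t)
    (h' : IsKummerParameter p (z ^ j) E (g ^ i) t') (hp : p ≠ 0)
    (hz : IsPrincipalRoot z p) :
    ∃ r : Rˣ, t' ^ i = t ^ j * r ^ p := by
  obtain ⟨hg, u, hu, ht⟩ := h
  obtain ⟨hgi, u', hu', ht'⟩ := h'
  have h1 : g ^ i • ((u' ^ i * (u ^ j)⁻¹ : E.Sˣ) : E.S) = ((u' ^ i * (u ^ j)⁻¹ : E.Sˣ) : E.S) := by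
    have h2 : g ^ i • (u : E.S) ^ j = (z ^ i) ^ j • (u : E.S) ^ j :=
      smul_pow_of_smul_eq (pow_smul_of_smul_eq hu i) j
    have h3 : g ^ i • (u' : E.S) ^ i = (z ^ j) ^ i • (u' : E.S) ^ i := smul_pow_of_smul_eq hu' i
    have hzu : IsUnit ((z ^ i) ^ j) :=
      ((IsUnit.of_mul_eq_one _ (hz.mul_pow_pred hp)).pow i).pow j
    have h4 : ((u' ^ i * (u ^ j)⁻¹ : E.Sˣ) : E.S) * (u : E.S) ^ j = (u' : E.S) ^ i := by
      rw [← Units.val_pow_eq_pow_val, ← Units.val_mul, inv_mul_cancel_right,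
        Units.val_pow_eq_pow_val]
    have h5 := congrArg (g ^ i • ·) h4
    simp only [smul_mul', h2, h3] at h5
    rw [← h4, mul_smul_comm, ← pow_mul, ← pow_mul, mul_comm j i] at h5
    rw [← pow_mul] at hzu
    have h6 := (hzu.smul_left_cancel).mp h5
    exact (u ^ j).isUnit.mul_right_cancel (by rw [Units.val_pow_eq_pow_val]; exact h6)
  obtain ⟨r, hr⟩ := E.isGalois.exists_unit_eq_of_smul_eq hgi h1
  refine ⟨r, Units.ext (E.isGalois.injective ?_)⟩
  have h2 : (u' ^ p) ^ i = (u ^ p) ^ j * (u' ^ i * (u ^ j)⁻¹) ^ p := by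
    rw [_root_.mul_pow, inv_pow, ← pow_mul, ← pow_mul, ← pow_mul, ← pow_mul, mul_comm p i,
      mul_comm p j, mul_left_comm, mul_inv_cancel, mul_one]
  have h3 := congrArg (Units.val) h2
  rw [Units.val_mul, Units.val_pow_eq_pow_val _ p, ← hr, Units.val_pow_eq_pow_val,
    Units.val_pow_eq_pow_val, Units.val_pow_eq_pow_val, Units.val_pow_eq_pow_val, ← ht, ← ht'] at h3
  simpa using h3

theorem exists_algEquiv (h : IsKummerParameter p z E g t) (hp : p ≠ 0) (hG : Nat.card G = p)
    (hz : IsPrincipalRoot z p) :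
    Nonempty (E.S ≃ₐ[R] AdjoinRoot (Polynomial.X ^ p - Polynomial.C (t : R))) := by
  obtain ⟨hg, u, hu, ht⟩ := h
  obtain ⟨e, -⟩ := E.isGalois.exists_adjoinRoot_algEquiv hp hG hz hg hu ht
  exact ⟨e.symm⟩

/-- Extensions with a common Kummer parameter are conjugate. -/
theorem conjugate (h : IsKummerParameter p z E g t) (h' : IsKummerParameter p z E' g' t)
    (hp : p ≠ 0) (hG : Nat.card G = p) (hH : Nat.card H = p) (hz : IsPrincipalRoot z p) :
    E.Conjugate E' := by
  obtain ⟨hg, u, hu, ht⟩ := h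
  obtain ⟨hg', u', hu', ht'⟩ := h'
  obtain ⟨e, he⟩ := E.isGalois.exists_adjoinRoot_algEquiv hp hG hz hg hu ht
  obtain ⟨e', he'⟩ := E'.isGalois.exists_adjoinRoot_algEquiv hp hH hz hg' hu' ht'
  have horder : orderOf g = orderOf g' := by
    rw [orderOf_eq_card_of_forall_mem_zpowers hg, orderOf_eq_card_of_forall_mem_zpowers hg', hG, hH]
  have hfin : Finite G := Nat.finite_of_card_ne_zero (hG ▸ hp)
  let φ : E.S ≃ₐ[R] E'.S := e.symm.trans e'
  let τ : G ≃* H := mulEquivOfOrderOfEq hg hg' horder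
  have hτ : τ g = g' := mulEquivOfOrderOfEq_apply_gen hg hg' horder
  have hgen (s : E.S) : φ (g • s) = g' • φ s := by
    have h1 : (φ.toAlgHom.comp (MulSemiringAction.toAlgHom R E.S g)).comp e.toAlgHom =
        ((MulSemiringAction.toAlgHom R E'.S g').comp φ.toAlgHom).comp e.toAlgHom := by
      refine AdjoinRoot.algHom_ext ?_
      change φ (g • e _) = g' • φ (e _)
      rw [he, hu, map_smul, ← he]
      change z • e' (e.symm (e _)) = g' • e' (e.symm (e _))
      rw [e.symm_apply_apply, he', hu']
    have h2 := DFunLike.congr_fun h1 (e.symm s)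
    change φ (g • e (e.symm s)) = g' • φ (e (e.symm s)) at h2
    rwa [e.apply_symm_apply] at h2
  refine ⟨φ, τ, fun a s => ?_⟩
  obtain ⟨n, rfl⟩ := (isOfFinOrder_of_finite g).mem_powers_iff_mem_zpowers.mpr (hg a)
  simp only
  rw [map_pow, hτ]
  induction n generalizing s with
  | zero => simp
  | succ n ih => rw [pow_succ, mul_smul, ih, hgen, pow_succ, mul_smul]

end IsKummerParameter

end KummerParameter

/-! ### Kummer parameters over the adele ring -/

section AdeleSelections

variable (X : Scheme.{u}) [NonsingularCurve X]

/-- At every point some summand of a partition of unity has valuation at most `0`; the selections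
are the indicator functions of a choice of such a summand, and `dᵢ` is the inverse of `rᵢ` where
`rᵢ` is chosen. -/
theorem hasOrthogonalSelections_adele : HasOrthogonalSelections (Adele X) := by
  classical
  intro ι s r hr
  have hsum (x : ClosedPoint X) : ∑ i ∈ s, r i x = 1 := by
    have h := congrArg (RestrictedProduct.evalRingHom (LocalField X) x) hr
    rwa [map_sum, map_one] at h
  have hex (x : ClosedPoint X) : ∃ i ∈ s, (1 : ℤᵐ⁰) ≤ Valued.v (r i x) := by
    by_contra! hlt
    have h := Valuation.map_sum_lt (Valued.v : Valuation (LocalField X x) ℤᵐ⁰) one_ne_zero hlt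
    rw [hsum, map_one] at h
    exact h.false
  choose j hjs hj using hex
  have hj0 (x : ClosedPoint X) : r (j x) x ≠ 0 := by
    intro h
    have h1 := hj x
    rw [h, map_zero] at h1
    exact zero_lt_one.not_ge h1
  let c (i : ι) : Adele X := ⟨fun x => if j x = i then 1 else 0,
    Filter.Eventually.of_forall fun x => by
      simp only
      split_ifs
      exacts [one_mem (LocalIntegers X x), zero_mem (LocalIntegers X x)]⟩
  let d (i : ι) : Adele X := ⟨fun x => if j x = i then (r i x)⁻¹ else 0,
    Filter.Eventually.of_forall fun x => by
      simp only
      split_ifs with h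
      · rw [SetLike.mem_coe, mem_localIntegers, map_inv₀, ← h]
        exact inv_le_one_of_one_le₀ (hj x)
      · exact zero_mem (LocalIntegers X x)⟩
  refine ⟨c, d, fun i l hil => RestrictedProduct.ext _ _ fun x => ?_,
    RestrictedProduct.ext _ _ fun x => ?_⟩
  · change (if j x = i then (1 : LocalField X x) else 0) * (if j x = l then (r l x)⁻¹ else 0) = 0
    by_cases h : j x = i
    · rw [if_neg (fun h' => hil (h.symm.trans h')), mul_zero]
    · rw [if_neg h, zero_mul]
  · change RestrictedProduct.evalRingHom (LocalField X) x (∑ i ∈ s, c i * d i * r i) = 1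
    rw [map_sum]
    change ∑ i ∈ s, (if j x = i then (1 : LocalField X x) else 0) *
      (if j x = i then (r i x)⁻¹ else 0) * r i x = 1
    rw [Finset.sum_eq_single_of_mem (j x) (hjs x)]
    · rw [if_pos rfl, if_pos rfl, one_mul, inv_mul_cancel₀ (hj0 x)]
    · intro i _ hi
      rw [if_neg hi.symm, zero_mul, zero_mul]

end AdeleSelections

section Residues

variable {X : Scheme.{u}} [NonsingularCurve X] {p : ℕ}

/-- The residue modulo `p` of the valuation of an idele at a point. -/
noncomputable def ordMod (p : ℕ) (t : (Adele X)ˣ) (x : ClosedPoint X) : ZMod p :=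
  (ord x ((t : Adele X) x) : ZMod p)

theorem ordMod_eq_zero_iff (t : (Adele X)ˣ) (x : ClosedPoint X) :
    ordMod p t x = 0 ↔ (p : ℤ) ∣ ord x ((t : Adele X) x) :=
  ZMod.intCast_zmod_eq_zero_iff_dvd _ p

theorem mem_ramificationLocus (t : (Adele X)ˣ) (x : ClosedPoint X) :
    x ∈ ramificationLocus p t ↔ ordMod p t x ≠ 0 :=
  (ordMod_eq_zero_iff t x).not.symm

theorem ordMod_mul (t t' : (Adele X)ˣ) (x : ClosedPoint X) :
    ordMod p (t * t') x = ordMod p t x + ordMod p t' x := by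
  unfold ordMod
  rw [Units.val_mul, RestrictedProduct.mul_apply,
    ord_mul x (idele_apply_ne_zero t x) (idele_apply_ne_zero t' x), Int.cast_add]

theorem ordMod_pow (t : (Adele X)ˣ) (n : ℕ) (x : ClosedPoint X) :
    ordMod p (t ^ n) x = n * ordMod p t x := by
  unfold ordMod
  rw [Units.val_pow_eq_pow_val, RestrictedProduct.pow_apply, ord_pow]
  push_cast
  rfl

theorem ordMod_mul_pow (t r : (Adele X)ˣ) (x : ClosedPoint X) :
    ordMod p (t * r ^ p) x = ordMod p t x := by
  rw [ordMod_mul, ordMod_pow, CharP.cast_eq_zero, zero_mul, add_zero]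

theorem exists_mul_pow_eq_of_ordMod_eq (k : Type u) [Field k] [IsAlgClosed k]
    [X.Over (Spec (CommRingCat.of k))] [LocallyOfFiniteType (X ↘ Spec (CommRingCat.of k))]
    (hp : (p : k) ≠ 0) {t t' : (Adele X)ˣ} (h : ∀ x, ordMod p t x = ordMod p t' x) :
    ∃ r : (Adele X)ˣ, t = t' * r ^ p := by
  obtain ⟨r, hr⟩ := exists_idele_pow_eq k hp (t * t'⁻¹) fun x => by
    rw [← ordMod_eq_zero_iff, ordMod_mul, h, ← ordMod_mul, mul_inv_cancel, ordMod_eq_zero_iff,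
      Units.val_one, RestrictedProduct.one_apply, ord_one]
    exact dvd_zero _
  exact ⟨r, by rw [hr, mul_comm, inv_mul_cancel_right]⟩

variable [Fact p.Prime]

/-- The ramification locus of an idele together with the class of the tuple of inverses of its
valuations modulo `p`. -/
noncomputable def ramificationData (p : ℕ) [Fact p.Prime] (t : (Adele X)ˣ) :
    Σ s : Finset (ClosedPoint X), TupleClass p s :=
  ⟨(finite_ramificationLocus p t).toFinset, TupleClass.mk fun x =>
    (Units.mk0 (ordMod p t x) ((mem_ramificationLocus t x.1).mp
      ((finite_ramificationLocus p t).mem_toFinset.mp x.2)))⁻¹⟩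

theorem ramificationData_eq_iff (t : (Adele X)ˣ) (s : Finset (ClosedPoint X))
    (v : s → (ZMod p)ˣ) :
    ramificationData p t = ⟨s, TupleClass.mk v⟩ ↔
      (s : Set (ClosedPoint X)) = ramificationLocus p t ∧
        ∃ m : (ZMod p)ˣ, ∀ x : s, (v x : ZMod p) * ordMod p t x = m := by
  have hloc : ((finite_ramificationLocus p t).toFinset : Set (ClosedPoint X)) =
      ramificationLocus p t := Set.Finite.coe_toFinset _
  constructor
  · intro h
    have hs : (finite_ramificationLocus p t).toFinset = s := congrArg Sigma.fst h
    subst hs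
    refine ⟨hloc, ?_⟩
    obtain ⟨m, hm⟩ := Quotient.exact (eq_of_heq (Sigma.mk.inj h).2)
    refine ⟨m⁻¹, fun x => ?_⟩
    have hx := congrArg Units.val (congrFun hm x)
    change (m : ZMod p) * v x = ((Units.mk0 (ordMod p t x) _)⁻¹ : (ZMod p)ˣ) at hx
    rw [Units.val_inv_eq_inv_val, Units.val_mk0] at hx
    have h0 := (mem_ramificationLocus t x.1).mp
      ((finite_ramificationLocus p t).mem_toFinset.mp x.2)
    rw [Units.val_inv_eq_inv_val]
    refine eq_inv_of_mul_eq_one_left ?_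
    rw [mul_right_comm, mul_comm _ (m : ZMod p), hx, inv_mul_cancel₀ h0]
  · rintro ⟨hs, m, hm⟩
    have hs' : (finite_ramificationLocus p t).toFinset = s :=
      Finset.coe_injective (hloc.trans hs.symm)
    subst hs'
    refine Sigma.ext rfl (heq_of_eq (Quotient.sound ⟨m⁻¹, funext fun x => ?_⟩))
    have h0 := (mem_ramificationLocus t x.1).mp
      ((finite_ramificationLocus p t).mem_toFinset.mp x.2)
    change m⁻¹ * v x = (Units.mk0 (ordMod p t x) _)⁻¹
    rw [eq_inv_iff_mul_eq_one, mul_assoc, inv_mul_eq_one]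
    exact Units.ext (hm x).symm

/-- Ideles with proportional valuations modulo `p` have the same ramification data. -/
theorem ramificationData_eq_ramificationData_iff (t t' : (Adele X)ˣ) :
    ramificationData p t = ramificationData p t' ↔
      ∃ m : (ZMod p)ˣ, ∀ x, ordMod p t x = m * ordMod p t' x := by
  have hloc : ((finite_ramificationLocus p t').toFinset : Set (ClosedPoint X)) =
      ramificationLocus p t' := Set.Finite.coe_toFinset _
  have h0 (x : (finite_ramificationLocus p t').toFinset) : ordMod p t' x ≠ 0 :=
    (mem_ramificationLocus t' x.1).mp ((finite_ramificationLocus p t').mem_toFinset.mp x.2)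
  have key := ramificationData_eq_iff t (finite_ramificationLocus p t').toFinset
    fun x => (Units.mk0 (ordMod p t' x) (h0 x))⁻¹
  refine key.trans ⟨?_, ?_⟩
  · rintro ⟨hs, m, hm⟩
    refine ⟨m, fun x => ?_⟩
    by_cases hx : x ∈ (finite_ramificationLocus p t').toFinset
    · have h := hm ⟨x, hx⟩
      rw [Units.val_inv_eq_inv_val, Units.val_mk0, inv_mul_eq_iff_eq_mul₀ (h0 ⟨x, hx⟩)] at h
      rw [h, mul_comm]
    · have h1 : x ∉ ramificationLocus p t' := fun h => hx (by simpa using h)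
      have h2 : x ∉ ramificationLocus p t := by rwa [← hs, hloc]
      rw [mem_ramificationLocus, not_not] at h1 h2
      rw [h1, h2, mul_zero]
  · rintro ⟨m, hm⟩
    refine ⟨?_, m, fun x => ?_⟩
    · rw [hloc]
      ext x
      rw [mem_ramificationLocus, mem_ramificationLocus, hm, mul_ne_zero_iff,
        and_iff_right m.ne_zero]
    · rw [hm, Units.val_inv_eq_inv_val, Units.val_mk0, mul_comm, mul_inv_cancel_right₀ (h0 x)]

theorem exists_ramificationData_eq (σ : Σ s : Finset (ClosedPoint X), TupleClass p s) :
    ∃ t : (Adele X)ˣ, ramificationData p t = σ := by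
  classical
  obtain ⟨s, q⟩ := σ
  induction q using Quotient.inductionOn with
  | h v =>
  obtain ⟨t, ht, ht'⟩ := exists_idele_ord_eq s
    fun x => if hx : x ∈ s then ((v ⟨x, hx⟩)⁻¹ : (ZMod p)ˣ).val.val else 0
  have h1 (x : s) : ordMod p t x = ((v x)⁻¹ : (ZMod p)ˣ) := by
    unfold ordMod
    rw [ht x.1 x.2, dif_pos x.2, Int.cast_natCast, ZMod.natCast_zmod_val]
  refine ⟨t, (ramificationData_eq_iff t s v).mpr ⟨?_, 1, fun x => ?_⟩⟩
  · ext x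
    rw [mem_ramificationLocus]
    by_cases hx : x ∈ s
    · simp only [Finset.mem_coe, hx, true_iff]
      rw [h1 ⟨x, hx⟩]
      exact Units.ne_zero _
    · simp only [Finset.mem_coe, hx, false_iff, not_not]
      unfold ordMod
      rw [ht' x hx, Int.cast_zero]
  · rw [h1, Units.mul_inv, Units.val_one]

end Residues

section Classification

variable {k : Type u} [Field k] {X : Scheme.{u}} [X.Over (Spec (CommRingCat.of k))]
  [NonsingularCurve X] {p : ℕ}

theorem not_dvd_of_forall_mem_zpowers_pow {G : Type v} [Group G] (hp : p.Prime)
    (hG : Nat.card G = p) {g : G} {i : ℕ} (hg : ∀ h : G, h ∈ Subgroup.zpowers (g ^ i)) :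
    ¬ p ∣ i := by
  rintro ⟨m, rfl⟩
  have h1 : orderOf (g ^ (p * m)) = p := by rw [orderOf_eq_card_of_forall_mem_zpowers hg, hG]
  rw [pow_mul, ← hG, pow_card_eq_one', one_pow, orderOf_one, hG] at h1
  exact hp.one_lt.ne h1

/-- The ramification data of a Kummer parameter depend only on the conjugacy class of the extension,
not on the generator, the root of unity and the parameter. -/
theorem ramificationData_eq_of_conjugate [hp : Fact p.Prime] {z : Adele X}
    (hz : IsPrincipalRoot z p) {G : Type v} {H : Type w} [Group G] [Group H]
    {E : GaloisExtension (Adele X) G} {E' : GaloisExtension (Adele X) H} (hH : Nat.card H = p)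
    (hE : E.Conjugate E') {g : G} {g' : H} {t t' : (Adele X)ˣ} {j : ℕ} (hj : ¬ p ∣ j)
    (h : IsKummerParameter p z E g t) (h' : IsKummerParameter p (z ^ j) E' g' t') :
    ramificationData p t = ramificationData p t' := by
  obtain ⟨φ, τ, hφ⟩ := hE
  have h1 := h.of_conjugate hφ
  have hfin : Finite H := Nat.finite_of_card_ne_zero (hH ▸ hp.out.ne_zero)
  obtain ⟨i, rfl⟩ := (isOfFinOrder_of_finite (τ g)).mem_powers_iff_mem_zpowers.mpr (h1.1 g')
  have hi := not_dvd_of_forall_mem_zpowers_pow hp.out hH h'.1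
  obtain ⟨r, hr⟩ := h1.pow_eq_pow_mul_pow h' hp.out.ne_zero hz
  have hi0 : (i : ZMod p) ≠ 0 := by rwa [Ne, ZMod.natCast_eq_zero_iff]
  have hj0 : (j : ZMod p) ≠ 0 := by rwa [Ne, ZMod.natCast_eq_zero_iff]
  rw [ramificationData_eq_ramificationData_iff]
  refine ⟨(Units.mk0 _ hj0)⁻¹ * Units.mk0 _ hi0, fun x => ?_⟩
  have h2 := congrArg (ordMod p · x) hr
  simp only [ordMod_mul_pow, ordMod_pow] at h2
  rw [Units.val_mul, Units.val_inv_eq_inv_val, Units.val_mk0, Units.val_mk0, mul_assoc, h2,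
    inv_mul_cancel_left₀ hj0]

/-- Extensions whose Kummer parameters have the same ramification data are conjugate: after a change
of generator the parameters differ by a `p`-th power. -/
theorem conjugate_of_ramificationData_eq [IsAlgClosed k]
    [LocallyOfFiniteType (X ↘ Spec (CommRingCat.of k))] (hpk : (p : k) ≠ 0) [hp : Fact p.Prime]
    {z : Adele X} (hz : IsPrincipalRoot z p) {G : Type v} {H : Type w} [Group G] [Group H]
    {E : GaloisExtension (Adele X) G} {E' : GaloisExtension (Adele X) H} (hG : Nat.card G = p)
    (hH : Nat.card H = p) {g : G} {g' : H} {t t' : (Adele X)ˣ}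
    (h : IsKummerParameter p z E g t) (h' : IsKummerParameter p z E' g' t')
    (heq : ramificationData p t = ramificationData p t') : E.Conjugate E' := by
  obtain ⟨m, hm⟩ := (ramificationData_eq_ramificationData_iff t t').mp heq
  have him : (m⁻¹ : (ZMod p)ˣ).val.val * m.val.val ≡ 1 [MOD p] := by
    rw [← ZMod.natCast_eq_natCast_iff]
    rw [Nat.cast_mul, ZMod.natCast_zmod_val, ZMod.natCast_zmod_val, Units.inv_mul, Nat.cast_one]
  have h1 := h'.generator_pow hz.pow_eq_one hH him
  obtain ⟨r, hr⟩ := exists_mul_pow_eq_of_ordMod_eq (p := p) k hpk (t := t)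
    (t' := t' ^ m.val.val) fun x => by rw [hm, ordMod_pow, ZMod.natCast_zmod_val]
  rw [hr] at h
  exact h.conjugate (h1.mul_pow r) hp.out.ne_zero hG hH hz

/-- The ramification locus of `t` depends only on the algebra `𝔸_X[T] / (T ^ p - t)`: it consists of
the points `x` at which this algebra has no homomorphism to `K_x`. -/
theorem mem_ramificationLocus_iff_isEmpty_algHom [IsAlgClosed k]
    [LocallyOfFiniteType (X ↘ Spec (CommRingCat.of k))] (hpk : (p : k) ≠ 0)
    {S : Type u} [CommRing S] [Algebra (Adele X) S] {t : (Adele X)ˣ}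
    (e : S ≃ₐ[Adele X] AdelicAlgebra p t) (x : ClosedPoint X) :
    x ∈ ramificationLocus p t ↔ IsEmpty (S →ₐ[Adele X] LocalField X x) := by
  have hmap : algebraMap (Adele X) (LocalField X x) t = (t : Adele X) x := rfl
  rw [ramificationLocus, Set.mem_ofPred_eq,
    ← exists_pow_eq_iff_dvd_ord k hpk x (idele_apply_ne_zero t x), ← not_nonempty_iff, not_iff_not]
  constructor
  · rintro ⟨b, hb⟩
    exact ⟨(adjoinRootHom p (t : Adele X) b (hb.trans hmap.symm)).comp e.toAlgHom⟩
  · rintro ⟨f⟩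
    refine ⟨f (e.symm (AdjoinRoot.root _)), ?_⟩
    rw [← map_pow, ← map_pow, adjoinRoot_root_pow, AlgEquiv.commutes, AlgHom.commutes, hmap]

/-! ### Local Kummer symbols -/

section KummerRoots

theorem one_tmul_smul {R : Type u} {K : Type v} {S : Type w} [CommRing R] [CommRing K] [CommRing S]
    [Algebra R K] [Algebra R S] (c : R) (s : S) :
    (1 : K) ⊗ₜ[R] (c • s) = algebraMap R K c • ((1 : K) ⊗ₜ[R] s) := by
  rw [TensorProduct.tmul_smul, algebraMap_smul]

theorem one_tmul_pow_eq {R : Type u} {K : Type v} {S : Type w} [CommRing R] [CommRing K]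
    [CommRing S] [Algebra R K] [Algebra R S] {p : ℕ} {t : R} {s : S}
    (hs : algebraMap R S t = s ^ p) :
    ((1 : K) ⊗ₜ[R] s) ^ p = algebraMap K (K ⊗[R] S) (algebraMap R K t) := by
  rw [Algebra.TensorProduct.tmul_pow, one_pow, ← hs, ← Algebra.TensorProduct.includeRight_apply,
    AlgHom.commutes]
  rfl

theorem isDomain_tensorProduct_of_irreducible {R : Type u} {K S : Type u} [CommRing R] [Field K]
    [CommRing S] [Algebra R K] [Algebra R S] {p : ℕ} {t : R} {s : S}
    (hs : algebraMap R S t = s ^ p)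
    (hspan : ∀ y : S, ∃ c : ℕ → R, y = ∑ i ∈ Finset.range p, c i • s ^ i)
    (hirr : Irreducible (Polynomial.X ^ p - Polynomial.C (algebraMap R K t)))
    [Nontrivial (K ⊗[R] S)] : IsDomain (K ⊗[R] S) := by
  have : Fact (Irreducible (Polynomial.X ^ p - Polynomial.C (algebraMap R K t))) := ⟨hirr⟩
  let f := adjoinRootHom p (algebraMap R K t) ((1 : K) ⊗ₜ[R] s) (one_tmul_pow_eq hs)
  have hf : (1 : K) ⊗ₜ[R] s ∈ f.range := f.mem_range.mpr ⟨AdjoinRoot.root _, adjoinRootHom_root ..⟩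
  have hsurj : Function.Surjective f := by
    rw [← AlgHom.range_eq_top, eq_top_iff]
    rintro y -
    induction y with
    | zero => exact zero_mem _
    | add a b ha hb => exact add_mem ha hb
    | tmul a y =>
      have h1 : a ⊗ₜ[R] y = a • ((1 : K) ⊗ₜ[R] y) := by
        rw [TensorProduct.smul_tmul', smul_eq_mul, mul_one]
      rw [h1]
      refine Subalgebra.smul_mem _ ?_ a
      obtain ⟨c, rfl⟩ := hspan y
      rw [TensorProduct.tmul_sum]
      refine sum_mem fun i _ => ?_
      have h2 : (1 : K) ⊗ₜ[R] (s ^ i) = ((1 : K) ⊗ₜ[R] s) ^ i := by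
        rw [Algebra.TensorProduct.tmul_pow, one_pow]
      rw [one_tmul_smul, h2]
      exact Subalgebra.smul_mem _ (pow_mem hf i) _
  exact MulEquiv.isDomain _
    (RingEquiv.ofBijective f.toRingHom ⟨f.toRingHom.injective, hsurj⟩).symm.toMulEquiv

variable {K : Type u} {L : Type v} [Field K] [CommRing L] [Algebra K L] {p : ℕ} {ζ : K}
  {f : L →ₐ[K] L}

theorem root_mul_pow_of_apply_eq_smul {y : L} {c τ b : K} {a : ℕ} (hy : y ^ p = algebraMap K L τ)
    (hf : f y = ζ • y) (hc : c ^ p * τ ^ a = b) :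
    (c • y ^ a) ^ p = algebraMap K L b ∧ f (c • y ^ a) = ζ ^ a • (c • y ^ a) := by
  constructor
  · rw [_root_.smul_pow, ← pow_mul, mul_comm, pow_mul, hy, ← map_pow, Algebra.smul_def, ← map_mul,
      hc]
  · rw [map_smul, map_pow, hf, _root_.smul_pow, smul_comm]

/-- If `L` is a domain, two elements with the same `p`-th power differ by a constant root of unity,
so an automorphism multiplies them by the same scalar. -/
theorem apply_eq_smul_of_pow_eq [IsDomain L] (hp : p ≠ 0) (hζ : IsPrimitiveRoot ζ p) {β₀ β : L}
    (hu : IsUnit β₀) {c : K} (hf : f β₀ = c • β₀) (hβ : β ^ p = β₀ ^ p) : f β = c • β := by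
  have hζL : IsPrimitiveRoot (algebraMap K L ζ) p :=
    hζ.map_of_injective (algebraMap K L).injective
  have : NeZero p := ⟨hp⟩
  obtain ⟨b, hb⟩ := hu.exists_right_inv
  obtain ⟨j, -, hj⟩ := hζL.eq_pow_of_pow_eq_one (ξ := β * b) (by
    rw [mul_pow, hβ, ← mul_pow, hb, one_pow])
  have hββ₀ : β = ζ ^ j • β₀ := by
    rw [Algebra.smul_def, map_pow, hj, mul_assoc, mul_comm b, hb, mul_one]
  rw [hββ₀, map_smul, hf, smul_comm]

end KummerRoots

section Local

variable {G : Type v} [Group G]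

/-- At a ramified point `S_x` is generated over `K_x` by a root of an irreducible polynomial
`T ^ p - t_x`. -/
theorem isDomain_of_mem_ramificationLocus {E : GaloisExtension (Adele X) G}
    (hp : p.Prime) (hG : Nat.card G = p) {z : Adele X} (hz : IsPrincipalRoot z p) {g : G}
    {t : (Adele X)ˣ} (h : IsKummerParameter p z E g t) {x : ClosedPoint X}
    (hx : x ∈ ramificationLocus p t) [Nontrivial (LocalField X x ⊗[Adele X] E.S)] :
    IsDomain (LocalField X x ⊗[Adele X] E.S) := by
  obtain ⟨hg, u, hu, ht⟩ := h
  exact isDomain_tensorProduct_of_irreducible ht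
    (E.isGalois.exists_eq_sum_pow hp.ne_zero hG hz hg hu)
    (X_pow_sub_C_irreducible_of_prime hp fun b hb => hx ⟨ord x b, by
      rw [← ord_pow, hb]
      rfl⟩)

/-- If `t` is a Kummer parameter ramified at `x`, the local Kummer symbol at `x` of an element of
valuation one is `ζ ^ a`, where `a` is the inverse of the valuation of `t` at `x` modulo `p`. -/
theorem isKummerSymbol_of_isKummerParameter [IsAlgClosed k]
    [LocallyOfFiniteType (X ↘ Spec (CommRingCat.of k))] (hpk : (p : k) ≠ 0) (hp : p.Prime)
    {E : GaloisExtension (Adele X) G} (hG : Nat.card G = p) {ζ : k} (hζ : IsPrimitiveRoot ζ p)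
    {g : G} {t : (Adele X)ˣ} (h : IsKummerParameter p (adeleConstants k ζ) E g t)
    {x : ClosedPoint X} (hx : x ∈ ramificationLocus p t) {z : LocalField X x} (hz : ord x z = 1)
    {a : ℕ} (ha : (a : ZMod p) * ordMod p t x = 1) :
    IsKummerSymbol p E x g z (constants k x ζ ^ a) := by
  have hroot := (hζ.isPrincipalRoot hpk).map (adeleConstants (X := X) k)
  -- By convention `ord x 0 = 0`.
  have hz0 : z ≠ 0 := by
    rintro rfl
    simp [ord] at hz
  obtain ⟨hg, u, hu, ht⟩ := id h
  let L := LocalField X x ⊗[Adele X] E.S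
  let ux : L := 1 ⊗ₜ (u : E.S)
  have hux : ux ^ p = algebraMap (LocalField X x) L ((t : Adele X) x) := one_tmul_pow_eq ht
  have hgux : localAction E x g ux = constants k x ζ • ux := by
    change (1 : LocalField X x) ⊗ₜ[Adele X] (g • (u : E.S)) = _
    rw [hu, one_tmul_smul]
    rfl
  have ht0 := idele_apply_ne_zero t x
  have hta0 : ((t : Adele X) x) ^ a ≠ 0 := pow_ne_zero _ ht0
  -- The elements `z` and `t_x ^ a` have the same valuation modulo `p`, so `z = c ^ p t_x ^ a`.
  obtain ⟨c, hc⟩ := (exists_pow_eq_iff_dvd_ord k hpk x (div_ne_zero hz0 hta0)).mpr (by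
    have h1 := ord_mul x (div_ne_zero hz0 hta0) hta0
    rw [div_mul_cancel₀ _ hta0, hz, ord_pow] at h1
    rw [← ZMod.intCast_zmod_eq_zero_iff_dvd]
    have h2 := congrArg (Int.cast : ℤ → ZMod p) h1
    push_cast at h2
    rw [show ((ord x ((t : Adele X) x) : ℤ) : ZMod p) = ordMod p t x from rfl, ha] at h2
    simpa using h2.symm)
  obtain ⟨hβ₀, hgβ₀⟩ := root_mul_pow_of_apply_eq_smul hux hgux (a := a)
    (show c ^ p * ((t : Adele X) x) ^ a = z by rw [hc, div_mul_cancel₀ _ hta0])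
  refine ⟨⟨_, hβ₀⟩, fun β hβ => ?_⟩
  rcases subsingleton_or_nontrivial L with _ | _
  · exact Subsingleton.elim (α := L) _ _
  have : IsDomain L := isDomain_of_mem_ramificationLocus hp hG hroot h hx
  refine apply_eq_smul_of_pow_eq hp.ne_zero (hζ.map_of_injective (constants k x).injective)
    ?_ hgβ₀ (hβ.trans hβ₀.symm)
  rw [← isUnit_pow_iff hp.ne_zero, hβ₀]
  exact hz0.isUnit.map _

end Local

end Classification

/-! ### The classification -/

theorem IsKummerParameter.exists_algEquiv_adelicAlgebra {X : Scheme.{u}} [NonsingularCurve X]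
    {p : ℕ} {G : Type v} [Group G] {E : GaloisExtension (Adele X) G} {z : Adele X} {g : G}
    {t : (Adele X)ˣ} (h : IsKummerParameter p z E g t) (hp : p ≠ 0) (hG : Nat.card G = p)
    (hz : IsPrincipalRoot z p) : Nonempty (E.S ≃ₐ[Adele X] AdelicAlgebra p t) :=
  h.exists_algEquiv hp hG hz

/-- The ramification locus is an invariant of the algebra `𝔸_X[T] / (T ^ p - t)`. -/
theorem ramificationLocus_eq_of_algEquiv {k : Type u} [Field k] [IsAlgClosed k] {X : Scheme.{u}}
    [X.Over (Spec (CommRingCat.of k))] [LocallyOfFiniteType (X ↘ Spec (CommRingCat.of k))]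
    [NonsingularCurve X] {p : ℕ} (hpk : (p : k) ≠ 0)
    {S : Type u} [CommRing S] [Algebra (Adele X) S] {t t' : (Adele X)ˣ}
    (e : S ≃ₐ[Adele X] AdelicAlgebra p t) (e' : S ≃ₐ[Adele X] AdelicAlgebra p t') :
    ramificationLocus p t = ramificationLocus p t' :=
  Set.ext fun x => (mem_ramificationLocus_iff_isEmpty_algHom hpk e x).trans
    (mem_ramificationLocus_iff_isEmpty_algHom hpk e' x).symm

/-- The exponents of the local Kummer symbols of an extension with Kummer parameter `t` are the
inverses of the valuations of `t` modulo `p`. -/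
theorem exists_tuple_isKummerSymbol {k : Type u} [Field k] [IsAlgClosed k] {X : Scheme.{u}}
    [X.Over (Spec (CommRingCat.of k))] [LocallyOfFiniteType (X ↘ Spec (CommRingCat.of k))]
    [NonsingularCurve X] {p : ℕ} [hp : Fact p.Prime] (hpk : (p : k) ≠ 0) {G : Type v} [Group G]
    {E : GaloisExtension (Adele X) G} (hG : Nat.card G = p) {ζ : k} (hζ : IsPrimitiveRoot ζ p)
    {g : G} {t : (Adele X)ˣ} (h : IsKummerParameter p (adeleConstants k ζ) E g t)
    {z : (x : ClosedPoint X) → LocalField X x} (hz : ∀ x, ord x (z x) = 1) :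
    ∃ (s : Finset (ClosedPoint X)) (v : s → (ZMod p)ˣ),
      (s : Set (ClosedPoint X)) = ramificationLocus p t ∧
        (∀ x : s, IsKummerSymbol p E x g (z x) (constants k x.1 ζ ^ (v x : ZMod p).val)) ∧
        ramificationData p t = ⟨s, TupleClass.mk v⟩ := by
  have hmem (x : (finite_ramificationLocus p t).toFinset) : x.1 ∈ ramificationLocus p t :=
    (finite_ramificationLocus p t).mem_toFinset.mp x.2
  have h0 (x : (finite_ramificationLocus p t).toFinset) : ordMod p t x ≠ 0 :=
    (mem_ramificationLocus t x.1).mp (hmem x)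
  refine ⟨(finite_ramificationLocus p t).toFinset, fun x => (Units.mk0 _ (h0 x))⁻¹,
    Set.Finite.coe_toFinset _, fun x => ?_, rfl⟩
  refine isKummerSymbol_of_isKummerParameter hpk hp.out hG hζ h (hmem x) (hz x) ?_
  rw [ZMod.natCast_zmod_val, Units.val_inv_eq_inv_val, Units.val_mk0, inv_mul_cancel₀ (h0 x)]

section Stratification

variable (k : Type u) [Field k] [IsAlgClosed k] (X : Scheme.{u})
  [X.Over (Spec (CommRingCat.of k))] [NonsingularCurve X] (p : ℕ) [hp : Fact p.Prime]

theorem PCyclicExtension.exists_generator {R : Type u} [CommRing R] {p : ℕ} [Fact p.Prime]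
    (E : PCyclicExtension R p) : ∃ g : E.G, ∀ h : E.G, h ∈ Subgroup.zpowers g :=
  (isCyclic_of_prime_card E.card_eq).exists_generator

/-- The conjugacy classes of `p`-cyclic extensions correspond to ramification data, a class being
sent to the data of any of its Kummer parameters. -/
theorem exists_conjugacyClasses_equiv [IsProper (X ↘ Spec (CommRingCat.of k))] (hpk : (p : k) ≠ 0) :
    ∃ Ψ : ConjugacyClasses (Adele X) p ≃ Σ s : Finset (ClosedPoint X), TupleClass p s,
      ∀ (E : PCyclicExtension (Adele X) p) (ζ : k), IsPrimitiveRoot ζ p →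
        ∀ (g : E.G) (t : (Adele X)ˣ), IsKummerParameter p (adeleConstants k ζ) E.ext g t →
          Ψ (ConjugacyClasses.mk E) = ramificationData p t := by
  have : NeZero (p : k) := ⟨hpk⟩
  obtain ⟨ζ₀, hζ₀⟩ := HasEnoughRootsOfUnity.exists_primitiveRoot k p
  have hz : IsPrincipalRoot (adeleConstants (X := X) k ζ₀) p :=
    (hζ₀.isPrincipalRoot hpk).map _
  have hex (E : PCyclicExtension (Adele X) p) : ∃ (g : E.G) (t : (Adele X)ˣ),
      IsKummerParameter p (adeleConstants k ζ₀) E.ext g t := by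
    obtain ⟨g, hg⟩ := E.exists_generator
    exact ⟨g, exists_isKummerParameter (hasOrthogonalSelections_adele X) hp.out hz E.ext
      E.card_eq hg⟩
  choose γ T hT using hex
  let F : ConjugacyClasses (Adele X) p → Σ s : Finset (ClosedPoint X), TupleClass p s :=
    Quotient.lift (fun E => ramificationData p (T E)) fun E E' hE =>
      ramificationData_eq_of_conjugate (j := 1) hz E'.card_eq hE hp.out.not_dvd_one (hT E)
        (by rw [pow_one]; exact hT E')
  have hF (E : PCyclicExtension (Adele X) p) (ζ : k) (hζ : IsPrimitiveRoot ζ p) (g : E.G)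
      (t : (Adele X)ˣ) (h : IsKummerParameter p (adeleConstants k ζ) E.ext g t) :
      F (ConjugacyClasses.mk E) = ramificationData p t := by
    obtain ⟨j, -, hj, rfl⟩ := hζ₀.isPrimitiveRoot_iff.mp hζ
    rw [map_pow] at h
    exact ramificationData_eq_of_conjugate hz E.card_eq
      ⟨AlgEquiv.refl, MulEquiv.refl _, fun _ _ => rfl⟩
      ((Nat.Prime.coprime_iff_not_dvd hp.out).mp hj.symm) (hT E) h
  refine ⟨Equiv.ofBijective F ⟨?_, ?_⟩, hF⟩
  · intro a b hab
    induction a using Quotient.inductionOn with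
    | h E =>
    induction b using Quotient.inductionOn with
    | h E' =>
    exact Quotient.sound
      (conjugate_of_ramificationData_eq hpk hz E.card_eq E'.card_eq (hT E) (hT E') hab)
  · intro σ
    have hX : CompactSpace X :=
      QuasiCompact.compactSpace_of_compactSpace (X ↘ Spec (CommRingCat.of k))
    have := nontrivial_adele X
    obtain ⟨t, rfl⟩ := exists_ramificationData_eq (p := p) σ
    obtain ⟨E, u, hu, ht⟩ := exists_galoisExtension_kummer_unit hp.out hz t
    exact ⟨ConjugacyClasses.mk E.toPCyclic,
      hF E.toPCyclic ζ₀ hζ₀ _ t ⟨mem_zpowers_ofAdd_one, u, hu, ht⟩⟩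

end Stratification

/-- Let `X` be a complete, irreducible, non-singular curve over an algebraically closed field `k`
and `p` a prime different from the characteristic of `k`. The classes of `C_p`-Galois extensions of
`𝔸_X` modulo `Aut(C_p)` are in bijection with the conjugacy classes of `p`-cyclic Galois
extensions, and the latter are in bijection with the disjoint union, over the finite sets of closed
points, of the tuples of units modulo `p` up to simultaneous multiplication. The second bijection
sends `(S, G)` to its ramification locus together with the class of the tuple of exponents of its
local Kummer symbols. -/
theorem corollaryC (k : Type u) [Field k] [IsAlgClosed k] (X : Scheme.{u})
    [X.Over (Spec (CommRingCat.of k))] [IsProper (X ↘ Spec (CommRingCat.of k))]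
    [NonsingularCurve X] (p : ℕ) [Fact p.Prime] (hp : (p : k) ≠ 0) :
    (∃ Φ : MulAction.orbitRel.Quotient (MulAut (CyclicGroup p))
          (Harrison (Adele X) (CyclicGroup p)) ≃ ConjugacyClasses (Adele X) p,
      ∀ E : GaloisExtension (Adele X) (CyclicGroup p),
        Φ (Quotient.mk _ (Harrison.mk E)) = ConjugacyClasses.mk E.toPCyclic) ∧
    (∃ Ψ : ConjugacyClasses (Adele X) p ≃ Σ s : Finset (ClosedPoint X), TupleClass p s,
      ∀ E : PCyclicExtension (Adele X) p,
        (∃ t : (Adele X)ˣ, Nonempty (E.ext.S ≃ₐ[Adele X] AdelicAlgebra p t)) ∧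
        ∀ t : (Adele X)ˣ, Nonempty (E.ext.S ≃ₐ[Adele X] AdelicAlgebra p t) →
          ∀ g : E.G, (∀ h : E.G, h ∈ Subgroup.zpowers g) →
          ∀ ζ : k, IsPrimitiveRoot ζ p →
          ∀ z : (x : ClosedPoint X) → LocalField X x, (∀ x, ord x (z x) = 1) →
            ∃ (s : Finset (ClosedPoint X)) (v : s → (ZMod p)ˣ),
              (s : Set (ClosedPoint X)) = ramificationLocus p t ∧
              (∀ x : s, IsKummerSymbol p E.ext x g (z x)
                (constants k x.1 ζ ^ (v x : ZMod p).val)) ∧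
              Ψ (ConjugacyClasses.mk E) = ⟨s, TupleClass.mk v⟩) := by
  refine ⟨exists_harrison_orbits_equiv_conjugacyClasses (Adele X) p, ?_⟩
  have hpp : p.Prime := Fact.out
  obtain ⟨Ψ, hΨ⟩ := exists_conjugacyClasses_equiv k X p hp
  have hroot {ζ : k} (hζ : IsPrimitiveRoot ζ p) :
      IsPrincipalRoot (adeleConstants (X := X) k ζ) p := (hζ.isPrincipalRoot hp).map _
  have hparam (E : PCyclicExtension (Adele X) p) {g : E.G}
      (hg : ∀ h : E.G, h ∈ Subgroup.zpowers g) {ζ : k} (hζ : IsPrimitiveRoot ζ p) :=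
    exists_isKummerParameter (hasOrthogonalSelections_adele X) hpp (hroot hζ) E.ext E.card_eq hg
  refine ⟨Ψ, fun E => ⟨?_, ?_⟩⟩
  · have : NeZero (p : k) := ⟨hp⟩
    obtain ⟨ζ, hζ⟩ := HasEnoughRootsOfUnity.exists_primitiveRoot k p
    obtain ⟨g, hg⟩ := E.exists_generator
    obtain ⟨t, ht⟩ := hparam E hg hζ
    exact ⟨t, ht.exists_algEquiv_adelicAlgebra hpp.ne_zero E.card_eq (hroot hζ)⟩
  · rintro t ⟨e⟩ g hg ζ hζ z hz
    -- The given `t` need not be a Kummer parameter, but it has the same ramification locus as one.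
    obtain ⟨t', ht'⟩ := hparam E hg hζ
    have he' : Nonempty (E.ext.S ≃ₐ[Adele X] AdelicAlgebra p t') :=
      ht'.exists_algEquiv_adelicAlgebra hpp.ne_zero E.card_eq (hroot hζ)
    obtain ⟨s, v, hs, hv, hΨs⟩ := exists_tuple_isKummerSymbol hp E.card_eq hζ ht' hz
    exact ⟨s, v, hs.trans (ramificationLocus_eq_of_algEquiv hp he'.some e), hv,
      (hΨ E ζ hζ g t' ht').trans hΨs⟩
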